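/- Let $\mathfrak h$ be a real separable Hilbert space with complexification $\mathfrak h_{\mathbb C}$ (inner product antilinear in the first argument, conjugation $k\mapsto\overline k$), let $\mathfrak H=\bigoplus_{n\ge0}\mathfrak h_{\mathbb C}^{\odot n}$ be the symmetric Fock space with exponential vectors $\mathcal E(f)=\sum_n f^{\otimes n}/\sqrt{n!}$, annihilation and creation operators $a(k)$, $a^+(k)=a(k)^*$ (where $a(k)$ is the closed operator with core $\mathrm{span}\,\{\mathcal E(f)\}$ given by $a(k)\mathcal E(f)=\langle k,f\rangle\mathcal E(f)$), and for $k\in\mathfrak h_{\mathbb C}$ let $Q(k)$ and $P(k)$ be the closures of $a(\overline k)+a^+(k)$ and of $i\big(a(\overline k)-a^+(k)\big)$. For $h_1,h_2\in\mathfrak h$ let $U(h_1,h_2)=\exp\big(iP(h_1)+iQ(h_2)\big)$ be the unitary Weyl operator, i.e. $U(h_1,h_2)\mathcal E(f)=e^{-\|z\|^2/2-\langle z,f\rangle}\mathcal E(f+z)$ with $z=h_1+ih_2$. For $h=(h_1,h_2)$ and a Schwartz function $\varphi$ on $\mathbb R^2$ let $O_h(\varphi)$ be the bounded operator on $\mathfrak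 H$ with $$\langle\mathcal E(f),O_h(\varphi)\mathcal E(g)\rangle=\frac1{2\pi}\int_{\mathbb R^2}\langle\mathcal E(f),U(uh_1,vh_2)\mathcal E(g)\rangle\,\mathcal F^{-1}\varphi(u,v)\,du\,dv\quad(f,g\in\mathfrak h_{\mathbb C}),$$ $$\mathcal F^{-1}\varphi(u,v)=\frac1{2\pi}\int_{\mathbb R^2}\varphi(x,y)e^{-i(ux+vy)}\,dx\,dy .$$ A locally integrable $w:\mathbb R^2\to\mathbb R$ is a Wigner density $w_{h,\Phi}$ of $(P(h_1),Q(h_2))$ in the state $\Phi$ if, for every Schwartz function $\varphi$, $\varphi$ lies in the domain of $O_h$, $\varphi w$ is integrable, and $\int\varphi w\,dx\,dy=\Phi(O_h(\varphi))$. Proposition. Let $\kappa\in\mathbb N=\{0,1,2,\dots\}$, let $h_1,h_2\in\mathfrak h$ with $\langle h_1,h_2\rangle\ne0$, let $\omega\in\mathfrak H$ be a unit vector and $\Phi(X)=\langle\omega,X\omega\rangle$ for bounded $X$. Suppose that there are $k_1,k_2\in\mathfrak h_{\mathbb C}$ with $\langle h_1,k_1\rangle\ne0$ and $\langle h_2,k_2\rangle\ne0$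 such that $$\omega\in\bigcap_{\kappa_1+\kappa_2\le\kappa}\mathrm{Dom}\,Q(k_1)^{\kappa_1}P(k_2)^{\kappa_2}\ \cap\bigcap_{\kappa_1+\kappa_2\le\kappa}\mathrm{Dom}\,Q(\overline{k}_1)^{\kappa_1}P(\overline{k}_2)^{\kappa_2}.$$ Then the Wigner density $w_{h,\Phi}$ exists and lies in $H^{p,\kappa}(\mathbb R^2)$ for all $2\le p\le\infty$: $w_{h,\Phi}\in L^p(\mathbb R^2)$ and all its weak partial derivatives of order at most $\kappa$ exist and lie in $L^p(\mathbb R^2)$. -/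

import Mathlib

open MeasureTheory Complex
open scoped TensorProduct ENNReal SchwartzMap InnerProductSpace

universe u

set_option linter.unusedSectionVars false

noncomputable section

namespace FockWigner

/-! ### Complexification of a real Hilbert space -/

section Complexification

variable (H : Type u) [NormedAddCommGroup H] [InnerProductSpace ℝ H]

/-- The complexification `H + iH` of a real inner product space `H`, as a set of pairs. -/
def Cplx : Type u := WithLp 2 (H × H)

namespace Cplx

instance : NormedAddCommGroup (Cplx H) := inferInstanceAs (NormedAddCommGroup (WithLp 2 (H × H)))

instance [CompleteSpace H] : CompleteSpace (Cplx H) :=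
  inferInstanceAs (CompleteSpace (WithLp 2 (H × H)))

variable {H}

/-- The vector `x + i y`. -/
def mk (x y : H) : Cplx H := WithLp.toLp 2 (x, y)

/-- Real part. -/
def re (z : Cplx H) : H := WithLp.fst z

/-- Imaginary part. -/
def im (z : Cplx H) : H := WithLp.snd z

/-- The embedding of the real Hilbert space; its range is the set of real vectors. -/
def ofReal (x : H) : Cplx H := mk x 0

/-- The conjugation `x + i y ↦ x - i y`. -/
def conj (z : Cplx H) : Cplx H := mk z.re (-z.im)

theorem ext {z w : Cplx H} (h1 : z.re = w.re) (h2 : z.im = w.im) : z = w :=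
  (WithLp.ofLp_injective 2) (Prod.ext h1 h2)

@[simp] theorem re_mk (x y : H) : (mk x y).re = x := rfl
@[simp] theorem im_mk (x y : H) : (mk x y).im = y := rfl
@[simp] theorem re_add (z w : Cplx H) : (z + w).re = z.re + w.re := rfl
@[simp] theorem im_add (z w : Cplx H) : (z + w).im = z.im + w.im := rfl
@[simp] theorem re_zero : (0 : Cplx H).re = 0 := rfl
@[simp] theorem im_zero : (0 : Cplx H).im = 0 := rfl

theorem norm_sq (z : Cplx H) : ‖z‖ ^ 2 = ‖z.re‖ ^ 2 + ‖z.im‖ ^ 2 :=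
  WithLp.prod_norm_sq_eq_of_L2 z

instance : SMul ℂ (Cplx H) :=
  ⟨fun c z => mk (c.re • z.re - c.im • z.im) (c.re • z.im + c.im • z.re)⟩

@[simp] theorem re_smul (c : ℂ) (z : Cplx H) : (c • z).re = c.re • z.re - c.im • z.im := rfl
@[simp] theorem im_smul (c : ℂ) (z : Cplx H) : (c • z).im = c.re • z.im + c.im • z.re := rfl

instance : Module ℂ (Cplx H) where
  one_smul z := by apply ext <;> simp
  mul_smul c d z := by
    apply ext <;> simp only [re_smul, im_smul, Complex.mul_re, Complex.mul_im] <;> module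
  smul_zero c := by apply ext <;> simp
  smul_add c z w := by
    apply ext <;> simp only [re_smul, im_smul, re_add, im_add] <;> module
  add_smul c d z := by
    apply ext <;> simp only [re_smul, im_smul, re_add, im_add, Complex.add_re, Complex.add_im] <;>
      module
  zero_smul z := by apply ext <;> simp

/-- The inner product, antilinear in the first argument, extending that of `H`. -/
instance : Inner ℂ (Cplx H) :=
  ⟨fun z w => ⟨⟪z.re, w.re⟫_ℝ + ⟪z.im, w.im⟫_ℝ, ⟪z.re, w.im⟫_ℝ - ⟪z.im, w.re⟫_ℝ⟩⟩

theorem inner_def (z w : Cplx H) : ⟪z, w⟫_ℂ =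
    ⟨⟪z.re, w.re⟫_ℝ + ⟪z.im, w.im⟫_ℝ, ⟪z.re, w.im⟫_ℝ - ⟪z.im, w.re⟫_ℝ⟩ := rfl

theorem norm_smul_eq (c : ℂ) (z : Cplx H) : ‖c • z‖ = ‖c‖ * ‖z‖ := by
  have h : ‖c • z‖ ^ 2 = (‖c‖ * ‖z‖) ^ 2 := by
    rw [mul_pow, norm_sq, norm_sq, re_smul, im_smul, norm_sub_sq_real, norm_add_sq_real,
      Complex.sq_norm, Complex.normSq_apply]
    simp only [norm_smul, inner_smul_left, inner_smul_right, mul_pow, Real.norm_eq_abs, sq_abs,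
      RCLike.conj_to_real, real_inner_comm]
    ring
  exact (sq_eq_sq₀ (norm_nonneg _) (by positivity)).1 h

instance : InnerProductSpace ℂ (Cplx H) where
  norm_smul_le c z := (norm_smul_eq c z).le
  norm_sq_eq_re_inner z := by
    rw [norm_sq, inner_def]
    simp
  conj_inner_symm z w := by
    rw [inner_def, inner_def]
    apply Complex.ext <;> simp [real_inner_comm]
  add_left z w v := by
    rw [inner_def, inner_def, inner_def]
    apply Complex.ext <;> simp [inner_add_left] <;> ring
  smul_left z w c := by
    rw [inner_def, inner_def]
    apply Complex.ext <;> simp [inner_add_left, inner_sub_left, inner_smul_left] <;> ring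

end Cplx

end Complexification

/-! ### Symmetric Fock space -/

section Fock

/-- A complex inner product space, bundled (used only to define tensor powers by recursion). -/
structure InnerSpace : Type (u + 1) where
  carrier : Type u
  [group : NormedAddCommGroup carrier]
  [space : InnerProductSpace ℂ carrier]

attribute [instance] InnerSpace.group InnerSpace.space

variable (K : Type u) [NormedAddCommGroup K] [InnerProductSpace ℂ K]

/-- The algebraic tensor power `K ⊗ (K ⊗ (⋯ ⊗ ℂ))` (`n` factors `K`), with the inner product
determined by `⟪x ⊗ y, x' ⊗ y'⟫ = ⟪x, x'⟫ ⟪y, y'⟫`. -/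
def tensorPow : ℕ → InnerSpace.{u}
  | 0 => ⟨EuclideanSpace ℂ PUnit.{u + 1}⟩
  | n + 1 => ⟨K ⊗[ℂ] (tensorPow n).carrier⟩

variable {K} in
/-- The algebraic tensor `k ⊗ ⋯ ⊗ k` with `n` factors. -/
def diagTensor (k : K) : (n : ℕ) → (tensorPow K n).carrier
  | 0 => EuclideanSpace.single PUnit.unit (1 : ℂ)
  | n + 1 => k ⊗ₜ[ℂ] diagTensor k n

variable {K} in
theorem norm_diagTensor (k : K) (n : ℕ) : ‖diagTensor k n‖ = ‖k‖ ^ n := by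
  induction n with
  | zero => exact (PiLp.norm_single 2 _ _ _).trans (by simp)
  | succ n ih =>
    rw [pow_succ', ← ih]
    exact TensorProduct.norm_tmul k (diagTensor k n)

/-- The Hilbert space tensor power. -/
def HilbertPow (n : ℕ) : Type u := UniformSpace.Completion (tensorPow K n).carrier

instance (n : ℕ) : NormedAddCommGroup (HilbertPow K n) :=
  inferInstanceAs (NormedAddCommGroup (UniformSpace.Completion (tensorPow K n).carrier))

instance (n : ℕ) : InnerProductSpace ℂ (HilbertPow K n) :=
  inferInstanceAs (InnerProductSpace ℂ (UniformSpace.Completion (tensorPow K n).carrier))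

instance (n : ℕ) : CompleteSpace (HilbertPow K n) :=
  inferInstanceAs (CompleteSpace (UniformSpace.Completion (tensorPow K n).carrier))

variable {K} in
/-- The tensor `k ⊗ ⋯ ⊗ k` with `n` factors in the Hilbert space tensor power. -/
def hilbertDiag (k : K) (n : ℕ) : HilbertPow K n :=
  (diagTensor k n : UniformSpace.Completion (tensorPow K n).carrier)

/-- The symmetric tensor power, as a closed subspace of the Hilbert space tensor power. By
polarisation, the span of the vectors `k ⊗ ⋯ ⊗ k` is the span of all symmetrised products. -/
def symPow (n : ℕ) : Submodule ℂ (HilbertPow K n) :=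
  (Submodule.span ℂ (Set.range fun k : K => hilbertDiag k n)).topologicalClosure

instance (n : ℕ) : CompleteSpace (symPow K n) := by
  unfold symPow
  infer_instance

/-- The symmetric Fock space: the Hilbert space direct sum of all symmetric tensor powers. -/
def Fock : Type u := lp (fun n : ℕ => symPow K n) 2

instance : NormedAddCommGroup (Fock K) :=
  inferInstanceAs (NormedAddCommGroup (lp (fun n : ℕ => symPow K n) 2))

instance : InnerProductSpace ℂ (Fock K) :=
  inferInstanceAs (InnerProductSpace ℂ (lp (fun n : ℕ => symPow K n) 2))

instance : CompleteSpace (Fock K) :=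
  inferInstanceAs (CompleteSpace (lp (fun n : ℕ => symPow K n) 2))

variable {K}

/-- The vector `k ⊗ ⋯ ⊗ k` in the symmetric tensor power. -/
def symTensor (k : K) (n : ℕ) : symPow K n :=
  ⟨hilbertDiag k n, Submodule.le_topologicalClosure _ (Submodule.subset_span ⟨k, rfl⟩)⟩

theorem norm_symTensor (k : K) (n : ℕ) : ‖symTensor k n‖ = ‖k‖ ^ n :=
  (UniformSpace.Completion.norm_coe (diagTensor k n)).trans (norm_diagTensor k n)

theorem memℓp_exponential (k : K) :
    Memℓp (fun n : ℕ => ((Real.sqrt (n.factorial : ℝ) : ℂ))⁻¹ • symTensor k n) 2 := by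
  apply memℓp_gen
  have h := Real.summable_pow_div_factorial (‖k‖ ^ 2)
  refine h.congr fun n => ?_
  have h2 : (2 : ℝ≥0∞).toReal = ((2 : ℕ) : ℝ) := by norm_num
  rw [h2, Real.rpow_natCast, norm_smul, norm_symTensor, norm_inv, Complex.norm_real,
    Real.norm_eq_abs, abs_of_nonneg (Real.sqrt_nonneg _), mul_pow, inv_pow,
    Real.sq_sqrt (Nat.cast_nonneg _)]
  ring

/-- The exponential vector `∑ₙ k^{⊗n} / √n!`. -/
def expVec (k : K) : Fock K :=
  (⟨fun n : ℕ => ((Real.sqrt (n.factorial : ℝ) : ℂ))⁻¹ • symTensor k n,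
    memℓp_exponential k⟩ : lp (fun n : ℕ => symPow K n) 2)

/-- The annihilation operator: the closure of the operator on the span of the exponential
vectors given by `a(h) 𝓔(f) = ⟪h, f⟫ 𝓔(f)`. -/
def annihilation (h : K) : Fock K →ₗ.[ℂ] Fock K :=
  (Submodule.span ℂ (Set.range fun f : K =>
    (expVec f, ⟪h, f⟫_ℂ • expVec f))).topologicalClosure.toLinearPMap

/-- The creation operator, the Hilbert space adjoint of the annihilation operator. -/
def creation (h : K) : Fock K →ₗ.[ℂ] Fock K := (annihilation h).adjoint

end Fock

/-! ### Unbounded operators -/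

section Unbounded

variable {F : Type*} [AddCommGroup F] [Module ℂ F]

/-- The product `A B` of unbounded operators, with domain `{x ∈ Dom B | B x ∈ Dom A}`. -/
def opMul (A B : F →ₗ.[ℂ] F) : F →ₗ.[ℂ] F :=
  A.comp (B.domRestrict ((A.domain.comap B.toFun).map B.domain.subtype)) (by
    rintro ⟨x, ⟨y, hy, rfl⟩, hx⟩
    exact hy)

/-- Powers of an unbounded operator, `A⁰ = 1` (everywhere defined), `Aⁿ⁺¹ = A Aⁿ`. -/
def opPow (A : F →ₗ.[ℂ] F) : ℕ → (F →ₗ.[ℂ] F)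
  | 0 => LinearMap.id.toPMap ⊤
  | n + 1 => opMul A (opPow A n)

theorem mem_opMul_domain (A B : F →ₗ.[ℂ] F) (x : F) :
    x ∈ (opMul A B).domain ↔ ∃ hx : x ∈ B.domain, B ⟨x, hx⟩ ∈ A.domain := by
  constructor
  · rintro ⟨⟨y, hy, rfl⟩, hx⟩
    exact ⟨hx, hy⟩
  · rintro ⟨hx, h⟩
    exact ⟨⟨⟨x, hx⟩, h, rfl⟩, hx⟩

end Unbounded

/-! ### Position, momentum, Weyl operators, Weyl calculus -/

section Weyl

variable {H : Type u} [NormedAddCommGroup H] [InnerProductSpace ℝ H]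

/-- The position operator `Q(k) = a(k̄) + a⁺(k)`, as a closed operator. -/
def Q (k : Cplx H) : Fock (Cplx H) →ₗ.[ℂ] Fock (Cplx H) :=
  (annihilation k.conj + creation k).closure

/-- The momentum operator `P(k) = i (a(k̄) - a⁺(k))`, as a closed operator. -/
def P (k : Cplx H) : Fock (Cplx H) →ₗ.[ℂ] Fock (Cplx H) :=
  (I • (annihilation k.conj - creation k)).closure

/-- The value `U(h₁, h₂) 𝓔(f)` of the (unitary) Weyl operator
`U(h₁, h₂) = exp (i P(h₁) + i Q(h₂)) = exp (a⁺(z) - a(z))`, `z = h₁ + i h₂`, for real `h₁, h₂`,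
on an exponential vector: `exp (-‖z‖² / 2 - ⟪z, f⟫) 𝓔(f + z)`. -/
def weylExp (h₁ h₂ : H) (f : Cplx H) : Fock (Cplx H) :=
  Complex.exp (-((‖Cplx.mk h₁ h₂‖ : ℂ) ^ 2) / 2 - ⟪Cplx.mk h₁ h₂, f⟫_ℂ) •
    expVec (f + Cplx.mk h₁ h₂)

/-- The inverse Fourier transform
`𝓕⁻¹φ(u, v) = (2π)⁻¹ ∫ φ(x, y) exp (-i (u x + v y)) dx dy`. -/
def invFourier (φ : ℝ × ℝ → ℂ) (w : ℝ × ℝ) : ℂ :=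
  (1 / (2 * Real.pi) : ℂ) *
    ∫ z : ℝ × ℝ, φ z * Complex.exp (-I * ((w.1 * z.1 + w.2 * z.2 : ℝ) : ℂ))

/-- `M = O_h(φ)`, i.e. the bounded operator `M` is the Weyl quantisation
`(2π)⁻¹ ∫ 𝓕⁻¹φ(u, v) U(u h₁, v h₂) du dv` of `φ`, weakly on exponential vectors. -/
def IsWeylQuantization (h₁ h₂ : H) (φ : ℝ × ℝ → ℂ)
    (M : Fock (Cplx H) →L[ℂ] Fock (Cplx H)) : Prop :=
  ∀ f g : Cplx H, ⟪expVec f, M (expVec g)⟫_ℂ =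
    (1 / (2 * Real.pi) : ℂ) *
      ∫ w : ℝ × ℝ, ⟪expVec f, weylExp (w.1 • h₁) (w.2 • h₂) g⟫_ℂ * invFourier φ w

/-- The domain of the Weyl calculus `O_h`. -/
def domO (h₁ h₂ : H) : Set (ℝ × ℝ → ℂ) := {φ | ∃ M, IsWeylQuantization h₁ h₂ φ M}

open Classical in
/-- The Weyl calculus `O_h` (with value `0` outside its domain). -/
def weylO (h₁ h₂ : H) (φ : ℝ × ℝ → ℂ) : Fock (Cplx H) →L[ℂ] Fock (Cplx H) :=
  if hφ : ∃ M, IsWeylQuantization h₁ h₂ φ M then hφ.choose else 0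

/-- The vector state `X ↦ ⟪ω, X ω⟫`. -/
def vectorState (ω : Fock (Cplx H)) (X : Fock (Cplx H) →L[ℂ] Fock (Cplx H)) : ℂ := ⟪ω, X ω⟫_ℂ

/-- `w` is a density of the Wigner distribution of `(P(h₁), Q(h₂))` in the state `Φ`:
`∫ φ w dx dy = Φ (O_h(φ))` for all Schwartz functions `φ` (all of which lie in `Dom O_h`). -/
def IsWignerDensity (h₁ h₂ : H) (Φ : (Fock (Cplx H) →L[ℂ] Fock (Cplx H)) → ℂ)
    (w : ℝ × ℝ → ℝ) : Prop :=
  LocallyIntegrable w ∧ ∀ φ : 𝓢(ℝ × ℝ, ℂ), (φ : ℝ × ℝ → ℂ) ∈ domO h₁ h₂ ∧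
    Integrable (fun z => φ z * (w z : ℂ)) ∧ ∫ z, φ z * (w z : ℂ) = Φ (weylO h₁ h₂ φ)

end Weyl

/-! ### Sobolev spaces on the plane -/

section Sobolev

/-- Partial derivative in the first variable. -/
def partialX (φ : ℝ × ℝ → ℝ) (z : ℝ × ℝ) : ℝ := fderiv ℝ φ z (1, 0)

/-- Partial derivative in the second variable. -/
def partialY (φ : ℝ × ℝ → ℝ) (z : ℝ × ℝ) : ℝ := fderiv ℝ φ z (0, 1)

/-- `g` is the weak derivative `∂ₓᵃ ∂ᵧᵇ w`. -/
def IsWeakDeriv (a b : ℕ) (w g : ℝ × ℝ → ℝ) : Prop :=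
  ∀ φ : ℝ × ℝ → ℝ, ContDiff ℝ ((⊤ : ℕ∞) : WithTop ℕ∞) φ → HasCompactSupport φ →
    ∫ z, (partialX^[a] (partialY^[b] φ)) z * w z = (-1) ^ (a + b) * ∫ z, φ z * g z

/-- The Sobolev space `H^{p,κ}(ℝ²)`: functions in `L^p` all of whose weak derivatives of order at
most `κ` exist and lie in `L^p`. -/
def MemSobolev (p : ℝ≥0∞) (κ : ℕ) (w : ℝ × ℝ → ℝ) : Prop :=
  MemLp w p ∧ ∀ a b : ℕ, a + b ≤ κ → ∃ g : ℝ × ℝ → ℝ, MemLp g p ∧ IsWeakDeriv a b w g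

end Sobolev

end FockWigner

end

/-!
Write `U(s) = exp (i s₁ P(h₁) + i s₂ Q(h₂))` for `s` in the plane, `c = ⟪h₁, h₂⟫` and
`χ(s) = ⟪ω, U(s) ω⟫`. The Wigner density is the Fourier transform of `χ`, and the proof shows that
the Fourier transform of every matrix coefficient `s ↦ ⟪x, U(s) y⟫` lies in `L² ∩ L^∞`.

The operators `U(s)` satisfy `U(s) U(t) = exp (-i c (s₁ t₂ - s₂ t₁)) U(s + t)`. The square of the
norm of `∫ exp (-ε |s|² + i ξ·s) U(s) y ds` is therefore an integral of `⟪y, U(r) y⟫` against a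
twisted autocorrelation of Gaussians, whose `L¹` norm stays bounded as `ε → 0` because `c ≠ 0`. This
is `norm_integral_modGaussian_smul_le`, stated for an arbitrary orbit-like map into a Hilbert space.
Applied to `U(s) y`, it bounds the Fourier transforms of matrix coefficients in `L^∞`. Applied to
`U(s) y ⊗ U(-s) x` in the tensor square of Fock space, where `c` becomes `2 c`, it bounds
`∫ exp (-ε |s|²) |⟪x, U(s) y⟫|² ds`, so that matrix coefficients are square integrable and
Plancherel's theorem applies. No Stone–von Neumann theorem is needed.

For the derivatives, `Q(k) U(s) - U(s) Q(k) = 2 s₁ ⟪h₁, k⟫ U(s)` and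
`P(k) U(s) - U(s) P(k) = -2 s₂ ⟪h₂, k⟫ U(s)` hold weakly on the domains of the closed operators
(`position_commutation`, `momentum_commutation`). Since `⟪h₁, k₁⟫` and `⟪h₂, k₂⟫` do not vanish,
`s₁ᵃ s₂ᵇ χ(s)` with `a + b ≤ κ` is a linear combination of matrix coefficients between the vectors
`Q(k̄₁)ʲ P(k̄₂)ⁱ ω` and `Q(k₁)ʲ P(k₂)ⁱ ω` (`monomial_mul_weylCoeff_mem_coeffSpan`), and its Fourier
transform is up to a factor the weak derivative `∂ₓᵃ ∂ᵧᵇ` of the density.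
-/

noncomputable section

namespace FockWigner

/-! ### Exponential vectors -/

section ExponentialVectors

variable {K : Type u} [NormedAddCommGroup K] [InnerProductSpace ℂ K]

theorem inner_diagTensor (f g : K) (n : ℕ) :
    ⟪diagTensor f n, diagTensor g n⟫_ℂ = ⟪f, g⟫_ℂ ^ n := by
  induction n with
  | zero =>
    have : ⟪(EuclideanSpace.single PUnit.unit (1 : ℂ) : EuclideanSpace ℂ PUnit.{u + 1}),
      EuclideanSpace.single PUnit.unit (1 : ℂ)⟫_ℂ = 1 := by simp
    rw [pow_zero]
    exact this
  | succ n ih =>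
    rw [pow_succ', ← ih]
    exact TensorProduct.inner_tmul (𝕜 := ℂ) f g (diagTensor f n) (diagTensor g n)

theorem inner_symTensor (f g : K) (n : ℕ) :
    ⟪symTensor f n, symTensor g n⟫_ℂ = ⟪f, g⟫_ℂ ^ n :=
  (UniformSpace.Completion.inner_coe (diagTensor f n) (diagTensor g n)).trans
    (inner_diagTensor f g n)

theorem diagTensor_smul (t : ℂ) (f : K) (n : ℕ) :
    diagTensor (t • f) n = t ^ n • diagTensor f n := by
  induction n with
  | zero => rw [pow_zero, one_smul]; rfl
  | succ n ih =>
    have h : (t • f) ⊗ₜ[ℂ] diagTensor (t • f) n = t ^ (n + 1) • (f ⊗ₜ[ℂ] diagTensor f n) := by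
      rw [ih, TensorProduct.smul_tmul_smul, pow_succ']
    exact h

theorem symTensor_smul (t : ℂ) (f : K) (n : ℕ) : symTensor (t • f) n = t ^ n • symTensor f n := by
  apply Subtype.ext
  have h : ((t ^ n • diagTensor f n : (tensorPow K n).carrier) :
      UniformSpace.Completion (tensorPow K n).carrier) =
      t ^ n • (diagTensor f n : UniformSpace.Completion (tensorPow K n).carrier) :=
    UniformSpace.Completion.coe_smul _ _
  rw [← diagTensor_smul] at h
  exact h

/-- A vector of Fock space as a square summable sequence. -/
def toSeq (x : Fock K) : lp (fun n : ℕ => symPow K n) 2 := x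

/-- The `n`-particle component of a vector of Fock space. -/
def component (x : Fock K) (n : ℕ) : symPow K n := toSeq x n

theorem fock_ext {x y : Fock K} (h : ∀ n, component x n = component y n) : x = y :=
  lp.ext (E := fun n : ℕ => symPow K n) (p := 2) (f := toSeq x) (g := toSeq y) (funext h)

theorem hasSum_inner_component (x y : Fock K) :
    HasSum (fun n => ⟪component x n, component y n⟫_ℂ) ⟪x, y⟫_ℂ :=
  lp.hasSum_inner (𝕜 := ℂ) (toSeq x) (toSeq y)

theorem component_expVec (f : K) (n : ℕ) :
    component (expVec f) n = ((Real.sqrt (n.factorial : ℝ) : ℂ))⁻¹ • symTensor f n := rfl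

theorem inner_expVec (f g : K) : ⟪expVec f, expVec g⟫_ℂ = Complex.exp ⟪f, g⟫_ℂ := by
  refine (hasSum_inner_component _ _).unique ?_
  rw [Complex.exp_eq_exp_ℂ]
  refine (NormedSpace.expSeries_div_hasSum_exp (𝔸 := ℂ) ⟪f, g⟫_ℂ).congr_fun fun n => ?_
  rw [component_expVec, component_expVec, inner_smul_left, inner_smul_right, inner_symTensor,
    map_inv₀, Complex.conj_ofReal, ← mul_assoc, ← mul_inv, ← Complex.ofReal_mul,
    Real.mul_self_sqrt (Nat.cast_nonneg _), Complex.ofReal_natCast]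
  ring

theorem norm_expVec_sq (f : K) : ‖expVec f‖ ^ 2 = Real.exp (‖f‖ ^ 2) := by
  have h := inner_expVec f f
  rw [inner_self_eq_norm_sq_to_K, inner_self_eq_norm_sq_to_K] at h
  simp only [Complex.coe_algebraMap] at h
  exact_mod_cast h

/-- A vector orthogonal to all exponential vectors vanishes: the scalar products with `𝓔(t f)`
form a power series in `t`, whose coefficients are the scalar products with the `f^{⊗n}`. -/
theorem eq_zero_of_forall_inner_expVec (x : Fock K) (h : ∀ f : K, ⟪expVec f, x⟫_ℂ = 0) :
    x = 0 := by
  have key : ∀ (f : K) (n : ℕ), ⟪symTensor f n, component x n⟫_ℂ = 0 := by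
    intro f n
    have hsum : ∀ s : ℂ, HasSum (fun n : ℕ => s ^ n •
        (((Real.sqrt (n.factorial : ℝ) : ℂ))⁻¹ * ⟪symTensor f n, component x n⟫_ℂ)) 0 := by
      intro s
      have h1 := hasSum_inner_component (expVec ((starRingEnd ℂ s) • f)) x
      rw [h] at h1
      refine h1.congr_fun fun n => ?_
      rw [component_expVec, symTensor_smul, inner_smul_left, inner_smul_left, map_inv₀,
        Complex.conj_ofReal, map_pow, Complex.conj_conj, smul_eq_mul]
      ring
    have hp : HasFPowerSeriesAt (fun _ : ℂ => (0 : ℂ)) (FormalMultilinearSeries.ofScalars ℂ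
        fun n : ℕ => ((Real.sqrt (n.factorial : ℝ) : ℂ))⁻¹ *
          ⟪symTensor f n, component x n⟫_ℂ) 0 := by
      rw [hasFPowerSeriesAt_iff]
      refine Filter.Eventually.of_forall fun s => ?_
      simpa only [FormalMultilinearSeries.coeff_ofScalars] using hsum s
    have h2 := congrArg (fun p => FormalMultilinearSeries.coeff p n) hp.eq_zero
    simp only [FormalMultilinearSeries.coeff_ofScalars] at h2
    have h3 : ((Real.sqrt (n.factorial : ℝ) : ℂ))⁻¹ ≠ 0 := by
      apply inv_ne_zero
      exact_mod_cast (Real.sqrt_pos.2 (by positivity)).ne'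
    have h4 : ((Real.sqrt (n.factorial : ℝ) : ℂ))⁻¹ * ⟪symTensor f n, component x n⟫_ℂ = 0 := h2
    exact (mul_eq_zero.1 h4).resolve_left h3
  apply fock_ext
  intro n
  -- A vector of the closed span of the `f^{⊗n}` orthogonal to all of them is zero.
  have hle : symPow K n ≤ (Submodule.span ℂ {(component x n : HilbertPow K n)})ᗮ := by
    refine Submodule.topologicalClosure_minimal _ (Submodule.span_le.2 ?_)
      (Submodule.isClosed_orthogonal _)
    rintro _ ⟨f, rfl⟩
    rw [SetLike.mem_coe, Submodule.mem_orthogonal_singleton_iff_inner_left]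
    exact key f n
  have h0 := hle (component x n).2
  rw [Submodule.mem_orthogonal_singleton_iff_inner_left, inner_self_eq_zero] at h0
  exact Subtype.ext h0

theorem dense_span_expVec :
    Dense ((Submodule.span ℂ (Set.range fun f : K => expVec f)) : Set (Fock K)) := by
  rw [Submodule.dense_iff_topologicalClosure_eq_top,
    Submodule.topologicalClosure_eq_top_iff, Submodule.eq_bot_iff]
  intro x hx
  refine eq_zero_of_forall_inner_expVec x fun f => ?_
  exact hx _ (Submodule.subset_span ⟨f, rfl⟩)

theorem continuous_expVec : Continuous fun f : K => expVec f := by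
  rw [continuous_iff_continuousAt]
  intro f
  rw [ContinuousAt, tendsto_iff_norm_sub_tendsto_zero]
  have h : ∀ g : K, ‖expVec g - expVec f‖ =
      Real.sqrt (Real.exp (‖g‖ ^ 2) - 2 * (Complex.exp ⟪g, f⟫_ℂ).re + Real.exp (‖f‖ ^ 2)) := by
    intro g
    rw [← norm_expVec_sq, ← norm_expVec_sq, ← inner_expVec, ← Real.sqrt_sq (norm_nonneg (_ - _)),
      norm_sub_sq (𝕜 := ℂ)]
    rfl
  simp_rw [h]
  have h0 : Real.sqrt (Real.exp (‖f‖ ^ 2) - 2 * (Complex.exp ⟪f, f⟫_ℂ).re + Real.exp (‖f‖ ^ 2))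
      = 0 := by rw [← h f, sub_self, norm_zero]
  rw [← h0]
  apply Continuous.tendsto (f := fun g : K =>
    Real.sqrt (Real.exp (‖g‖ ^ 2) - 2 * (Complex.exp ⟪g, f⟫_ℂ).re + Real.exp (‖f‖ ^ 2)))
  fun_prop

end ExponentialVectors

/-! ### Weyl operators -/

section WeylOperators

/-- Families with the same Gram matrix have linear combinations of the same norm. -/
theorem norm_linearCombination_eq {ι E F : Type*} [NormedAddCommGroup E] [InnerProductSpace ℂ E]
    [NormedAddCommGroup F] [InnerProductSpace ℂ F] {v : ι → E} {w : ι → F}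
    (h : ∀ i j, ⟪v i, v j⟫_ℂ = ⟪w i, w j⟫_ℂ) (c : ι →₀ ℂ) :
    ‖Finsupp.linearCombination ℂ v c‖ = ‖Finsupp.linearCombination ℂ w c‖ := by
  have h2 : ⟪Finsupp.linearCombination ℂ v c, Finsupp.linearCombination ℂ v c⟫_ℂ =
      ⟪Finsupp.linearCombination ℂ w c, Finsupp.linearCombination ℂ w c⟫_ℂ := by
    simp only [Finsupp.linearCombination_apply, Finsupp.sum, sum_inner, inner_sum,
      inner_smul_left, inner_smul_right, h]
  rw [inner_self_eq_norm_sq_to_K, inner_self_eq_norm_sq_to_K] at h2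
  have h3 : ‖Finsupp.linearCombination ℂ v c‖ ^ 2 = ‖Finsupp.linearCombination ℂ w c‖ ^ 2 := by
    exact_mod_cast h2
  exact (sq_eq_sq₀ (norm_nonneg _) (norm_nonneg _)).1 h3

variable {K : Type u} [NormedAddCommGroup K] [InnerProductSpace ℂ K]

/-- The vector `exp (-‖z‖² / 2 - ⟪z, f⟫) 𝓔(f + z)`. -/
def shiftedExpVec (z f : K) : Fock K :=
  Complex.exp (-((‖z‖ : ℂ) ^ 2) / 2 - ⟪z, f⟫_ℂ) • expVec (f + z)

theorem inner_shiftedExpVec (z f g : K) :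
    ⟪shiftedExpVec z f, shiftedExpVec z g⟫_ℂ = ⟪expVec f, expVec g⟫_ℂ := by
  rw [shiftedExpVec, shiftedExpVec, inner_smul_left, inner_smul_right, inner_expVec, inner_expVec,
    ← Complex.exp_conj, ← Complex.exp_add, ← Complex.exp_add]
  congr 1
  simp only [map_sub, map_div₀, map_neg, map_pow, Complex.conj_ofReal, inner_conj_symm,
    inner_add_left, inner_add_right, inner_self_eq_norm_sq_to_K, Complex.coe_algebraMap,
    map_ofNat]
  ring

theorem denseRange_linearCombination_expVec :
    DenseRange (Finsupp.linearCombination ℂ fun f : K => expVec f) := by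
  have h := dense_span_expVec (K := K)
  rw [← Finsupp.range_linearCombination] at h
  exact h

/-- The Weyl operator `exp (a⁺(z) - a(z))`: the bounded extension of
`𝓔(f) ↦ exp (-‖z‖² / 2 - ⟪z, f⟫) 𝓔(f + z)`. -/
def weyl (z : K) : Fock K →L[ℂ] Fock K :=
  (Finsupp.linearCombination ℂ (shiftedExpVec z)).extendOfNorm
    (Finsupp.linearCombination ℂ fun f : K => expVec f)

theorem weyl_expVec (z f : K) : weyl z (expVec f) = shiftedExpVec z f := by
  have h := LinearMap.extendOfNorm_eq (f := Finsupp.linearCombination ℂ (shiftedExpVec z))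
    (denseRange_linearCombination_expVec (K := K))
    ⟨1, fun c => by rw [one_mul, norm_linearCombination_eq (inner_shiftedExpVec z) c]⟩
    (Finsupp.single f 1)
  simpa using! h

theorem norm_weyl_apply_le (z : K) (x : Fock K) : ‖weyl z x‖ ≤ ‖x‖ := by
  have h := LinearMap.norm_extendOfNorm_apply_le
    (f := Finsupp.linearCombination ℂ (shiftedExpVec z))
    (denseRange_linearCombination_expVec (K := K)) 1
    (fun c => by rw [one_mul, norm_linearCombination_eq (inner_shiftedExpVec z) c]) x
  rwa [one_mul] at h

/-- Bounded operators agreeing on all exponential vectors coincide. -/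
theorem clm_ext_expVec {F : Type*} [NormedAddCommGroup F] [NormedSpace ℂ F]
    {S T : Fock K →L[ℂ] F} (h : ∀ f, S (expVec f) = T (expVec f)) : S = T :=
  ContinuousLinearMap.ext_on dense_span_expVec (by rintro _ ⟨f, rfl⟩; exact h f)

/-- The Weyl form of the canonical commutation relations. -/
theorem weyl_weyl (z w : K) (x : Fock K) :
    weyl z (weyl w x) = Complex.exp (-I * (⟪z, w⟫_ℂ).im) • weyl (z + w) x := by
  have h : (weyl z).comp (weyl w) = Complex.exp (-I * (⟪z, w⟫_ℂ).im) • weyl (z + w) := by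
    refine clm_ext_expVec fun f => ?_
    rw [ContinuousLinearMap.comp_apply, _root_.smul_apply, weyl_expVec, weyl_expVec,
      shiftedExpVec, shiftedExpVec, map_smul, weyl_expVec, shiftedExpVec, smul_smul, smul_smul,
      ← Complex.exp_add, ← Complex.exp_add, add_assoc, add_comm w z]
    congr 2
    have h1 : ((‖z + w‖ : ℂ)) ^ 2 = (‖z‖ : ℂ) ^ 2 + 2 * (⟪z, w⟫_ℂ).re + (‖w‖ : ℂ) ^ 2 := by
      exact_mod_cast norm_add_sq (𝕜 := ℂ) z w
    rw [h1, inner_add_right, inner_add_left]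
    conv_lhs => rw [← Complex.re_add_im ⟪z, w⟫_ℂ]
    ring
  exact DFunLike.congr_fun h x

theorem weyl_zero (x : Fock K) : weyl 0 x = x := by
  have h : weyl (0 : K) = ContinuousLinearMap.id ℂ (Fock K) := by
    refine clm_ext_expVec fun f => ?_
    simp [weyl_expVec, shiftedExpVec]
  rw [h]
  rfl

theorem weyl_neg_weyl (z : K) (x : Fock K) : weyl (-z) (weyl z x) = x := by
  have h : (⟪-z, z⟫_ℂ).im = 0 := by
    rw [inner_neg_left, Complex.neg_im, neg_eq_zero]
    exact inner_self_im (𝕜 := ℂ) z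
  rw [weyl_weyl, h, neg_add_cancel, weyl_zero]
  simp

theorem norm_weyl_apply (z : K) (x : Fock K) : ‖weyl z x‖ = ‖x‖ := by
  refine le_antisymm (norm_weyl_apply_le z x) ?_
  conv_lhs => rw [← weyl_neg_weyl z x]
  exact norm_weyl_apply_le _ _

theorem inner_weyl_weyl (z : K) (x y : Fock K) : ⟪weyl z x, weyl z y⟫_ℂ = ⟪x, y⟫_ℂ :=
  (LinearMap.norm_map_iff_inner_map_map (weyl z)).1 (norm_weyl_apply z) x y

theorem inner_weyl_left (z : K) (x y : Fock K) : ⟪weyl z x, y⟫_ℂ = ⟪x, weyl (-z) y⟫_ℂ := by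
  rw [← inner_weyl_weyl (-z) (weyl z x), weyl_neg_weyl]

/-- Strong continuity of the Weyl operators. -/
theorem continuous_weyl_apply (x : Fock K) : Continuous fun z : K => weyl z x := by
  have key : ∀ x ∈ Submodule.span ℂ (Set.range fun f : K => expVec f),
      Continuous fun z : K => weyl z x := by
    intro x hx
    induction hx using Submodule.span_induction with
    | mem x hx =>
      obtain ⟨f, rfl⟩ := hx
      simp only [weyl_expVec, shiftedExpVec]
      have h1 : Continuous fun z : K => expVec (f + z) :=
        (continuous_expVec (K := K)).comp (continuous_const_add f)
      have h2 : Continuous fun z : K => Complex.exp (-((‖z‖ : ℂ) ^ 2) / 2 - ⟪z, f⟫_ℂ) := by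
        fun_prop
      exact h2.smul h1
    | zero => simpa using! continuous_const
    | add x y _ _ hx hy => simpa only [map_add] using! hx.add hy
    | smul c x _ hx => simpa only [map_smul] using! hx.const_smul c
  rw [Metric.continuous_iff']
  intro z ε hε
  obtain ⟨y, hy, hxy⟩ := Metric.dense_iff.1 (dense_span_expVec (K := K)) x (ε / 3) (by positivity)
  have h1 := Metric.continuous_iff'.1 (key y hxy) z (ε / 3) (by positivity)
  filter_upwards [h1] with w hw
  rw [Metric.mem_ball, dist_eq_norm] at hy
  have h2 : ∀ v : K, dist (weyl v y) (weyl v x) < ε / 3 := by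
    intro v
    rw [dist_eq_norm, ← map_sub, norm_weyl_apply]
    exact hy
  calc dist (weyl w x) (weyl z x)
      ≤ dist (weyl w x) (weyl w y) + dist (weyl w y) (weyl z y) + dist (weyl z y) (weyl z x) :=
        dist_triangle4 _ _ _ _
    _ < ε / 3 + ε / 3 + ε / 3 := by
        have := h2 w
        rw [dist_comm] at this
        linarith [h2 z]
    _ = ε := by ring

end WeylOperators

/-! ### The projective representation of the plane generated by `P(h₁)` and `Q(h₂)` -/

section PhaseSpace

variable {H : Type u} [NormedAddCommGroup H] [InnerProductSpace ℝ H]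

/-- The unitary `exp (i s₁ P(h₁) + i s₂ Q(h₂))`. -/
def planeWeyl (h₁ h₂ : H) (s : ℝ × ℝ) : Fock (Cplx H) →L[ℂ] Fock (Cplx H) :=
  weyl (Cplx.mk (s.1 • h₁) (s.2 • h₂))

variable (h₁ h₂ : H)

theorem planeWeyl_expVec (s : ℝ × ℝ) (f : Cplx H) :
    planeWeyl h₁ h₂ s (expVec f) = weylExp (s.1 • h₁) (s.2 • h₂) f :=
  weyl_expVec _ _

theorem norm_planeWeyl_apply (s : ℝ × ℝ) (x : Fock (Cplx H)) : ‖planeWeyl h₁ h₂ s x‖ = ‖x‖ :=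
  norm_weyl_apply _ _

theorem mk_neg (x y : H) : Cplx.mk (-x) (-y) = -Cplx.mk x y := rfl

theorem inner_planeWeyl_left (s : ℝ × ℝ) (x y : Fock (Cplx H)) :
    ⟪planeWeyl h₁ h₂ s x, y⟫_ℂ = ⟪x, planeWeyl h₁ h₂ (-s) y⟫_ℂ := by
  rw [planeWeyl, planeWeyl, inner_weyl_left, ← mk_neg, Prod.fst_neg, Prod.snd_neg, neg_smul,
    neg_smul]

theorem planeWeyl_planeWeyl (s t : ℝ × ℝ) (x : Fock (Cplx H)) :
    planeWeyl h₁ h₂ s (planeWeyl h₁ h₂ t x) =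
      Complex.exp (-I * (⟪h₁, h₂⟫_ℝ * (s.1 * t.2 - s.2 * t.1) : ℝ)) •
        planeWeyl h₁ h₂ (s + t) x := by
  rw [planeWeyl, planeWeyl, planeWeyl, weyl_weyl, Cplx.inner_def]
  have h1 : Cplx.mk ((s + t).1 • h₁) ((s + t).2 • h₂) =
      Cplx.mk (s.1 • h₁) (s.2 • h₂) + Cplx.mk (t.1 • h₁) (t.2 • h₂) := by
    apply Cplx.ext <;> simp [add_smul]
  rw [h1]
  congr 4
  simp only [Cplx.re_mk, Cplx.im_mk, inner_smul_left, inner_smul_right, RCLike.conj_to_real]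
  rw [real_inner_comm h₁ h₂]
  ring

theorem inner_planeWeyl_planeWeyl (s t : ℝ × ℝ) (x : Fock (Cplx H)) :
    ⟪planeWeyl h₁ h₂ s x, planeWeyl h₁ h₂ t x⟫_ℂ =
      Complex.exp (I * (⟪h₁, h₂⟫_ℝ * (s.1 * t.2 - s.2 * t.1) : ℝ)) *
        ⟪x, planeWeyl h₁ h₂ (t - s) x⟫_ℂ := by
  rw [inner_planeWeyl_left, planeWeyl_planeWeyl, inner_smul_right, neg_add_eq_sub]
  congr 2
  simp only [Prod.fst_neg, Prod.snd_neg]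
  push_cast
  ring

theorem continuous_planeWeyl_apply (x : Fock (Cplx H)) :
    Continuous fun s : ℝ × ℝ => planeWeyl h₁ h₂ s x := by
  have h : Continuous fun s : ℝ × ℝ => Cplx.mk (s.1 • h₁) (s.2 • h₂) := by
    have : Continuous fun s : ℝ × ℝ => (s.1 • h₁, s.2 • h₂) := by fun_prop
    exact (WithLp.prod_continuous_toLp 2 H H).comp this
  exact (continuous_weyl_apply x).comp h

end PhaseSpace

/-! ### Gaussian regularisation of twisted orbits -/

section TwistedOrbits

/-- The plane Gaussian `exp (-ε |s|²)`. -/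
def planeGaussian (ε : ℝ) (s : ℝ × ℝ) : ℝ := Real.exp (-ε * s.1 ^ 2) * Real.exp (-ε * s.2 ^ 2)

theorem planeGaussian_pos (ε : ℝ) (s : ℝ × ℝ) : 0 < planeGaussian ε s := by
  unfold planeGaussian
  positivity

@[fun_prop]
theorem continuous_planeGaussian (ε : ℝ) : Continuous (planeGaussian ε) := by
  unfold planeGaussian
  fun_prop

theorem integrable_planeGaussian {ε : ℝ} (hε : 0 < ε) : Integrable (planeGaussian ε) :=
  (integrable_exp_neg_mul_sq hε).mul_prod (integrable_exp_neg_mul_sq hε)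

theorem integral_planeGaussian {ε : ℝ} (hε : 0 < ε) : ∫ s, planeGaussian ε s = Real.pi / ε := by
  have h : ∫ s, planeGaussian ε s = (∫ x : ℝ, Real.exp (-ε * x ^ 2)) *
      ∫ x : ℝ, Real.exp (-ε * x ^ 2) :=
    integral_prod_mul (fun x : ℝ => Real.exp (-ε * x ^ 2)) fun x : ℝ => Real.exp (-ε * x ^ 2)
  rw [h, integral_gaussian, Real.mul_self_sqrt (by positivity)]

/-- The quadratic form `a² + (a + b)²` dominates `(a² + b²) / 3`, which separates the variables. -/
theorem planeGaussian_mul_le {ε : ℝ} (hε : 0 < ε) (s r : ℝ × ℝ) :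
    planeGaussian ε s * planeGaussian ε (s + r) ≤
      planeGaussian (ε / 3) s * planeGaussian (ε / 3) r := by
  simp only [planeGaussian, ← Real.exp_add, Prod.fst_add, Prod.snd_add]
  rw [Real.exp_le_exp]
  have h : ∀ a b : ℝ, a ^ 2 + b ^ 2 ≤ 3 * (a ^ 2 + (a + b) ^ 2) := fun a b => by
    nlinarith [sq_nonneg (5 * a + 3 * b), sq_nonneg b]
  nlinarith [mul_le_mul_of_nonneg_left (h s.1 r.1) hε.le,
    mul_le_mul_of_nonneg_left (h s.2 r.2) hε.le]

/-- The Gaussian weight modulated by the character `exp (i (ξ₁ s₁ + ξ₂ s₂))`. -/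
def modGaussian (ε : ℝ) (ξ s : ℝ × ℝ) : ℂ :=
  planeGaussian ε s * Complex.exp (I * (ξ.1 * s.1 + ξ.2 * s.2 : ℝ))

theorem norm_modGaussian (ε : ℝ) (ξ s : ℝ × ℝ) : ‖modGaussian ε ξ s‖ = planeGaussian ε s := by
  rw [modGaussian, norm_mul, mul_comm I, Complex.norm_exp_ofReal_mul_I, mul_one, Complex.norm_real,
    Real.norm_of_nonneg (planeGaussian_pos _ _).le]

@[fun_prop]
theorem continuous_modGaussian (ε : ℝ) (ξ : ℝ × ℝ) : Continuous (modGaussian ε ξ) := by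
  unfold modGaussian
  fun_prop

/-- The twisted autocorrelation of the Gaussian decays like a Gaussian whose width tends to zero
with `ε`, which compensates the growth of the prefactor. -/
theorem norm_integral_twisted_gaussian {ε : ℝ} (hε : 0 < ε) (c : ℝ) (r : ℝ × ℝ) :
    ‖∫ s : ℝ × ℝ, (planeGaussian ε s * planeGaussian ε (s + r) : ℂ) *
      Complex.exp (I * (c * (s.1 * r.2 - s.2 * r.1) : ℝ))‖ =
      Real.pi / (2 * ε) * planeGaussian (ε / 2 + c ^ 2 / (8 * ε)) r := by
  have h1 : ∀ s : ℝ × ℝ, (planeGaussian ε s * planeGaussian ε (s + r) : ℂ) *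
      Complex.exp (I * (c * (s.1 * r.2 - s.2 * r.1) : ℝ)) =
      Complex.exp ((-2 * ε : ℂ) * (s.1 : ℂ) ^ 2 + (-2 * ε * r.1 + I * (c * r.2)) * s.1 +
        (-ε * r.1 ^ 2)) *
      Complex.exp ((-2 * ε : ℂ) * (s.2 : ℂ) ^ 2 + (-2 * ε * r.2 - I * (c * r.1)) * s.2 +
        (-ε * r.2 ^ 2)) := by
    intro s
    simp only [planeGaussian, Prod.fst_add, Prod.snd_add, Complex.ofReal_mul, Complex.ofReal_exp,
      ← Complex.exp_add]
    congr 1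
    push_cast
    ring
  simp_rw [h1]
  have h2 := integral_prod_mul (μ := (volume : Measure ℝ)) (ν := (volume : Measure ℝ))
    (fun x : ℝ => Complex.exp ((-2 * ε : ℂ) * (x : ℂ) ^ 2 + (-2 * ε * r.1 + I * (c * r.2)) * x +
        (-ε * r.1 ^ 2)))
    (fun x : ℝ => Complex.exp ((-2 * ε : ℂ) * (x : ℂ) ^ 2 + (-2 * ε * r.2 - I * (c * r.1)) * x +
        (-ε * r.2 ^ 2)))
  have hb : (-2 * ε : ℂ).re < 0 := by simpa using hε
  rw [Measure.volume_eq_prod, h2, integral_cexp_quadratic hb, integral_cexp_quadratic hb,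
    norm_mul, norm_mul, norm_mul, Complex.norm_exp, Complex.norm_exp]
  have h3 : ((Real.pi : ℂ) / -(-2 * ε)) = ((Real.pi / (2 * ε) : ℝ) : ℂ) := by
    push_cast
    ring
  have h4 : ‖((Real.pi : ℂ) / -(-2 * ε)) ^ (1 / 2 : ℂ)‖ = Real.sqrt (Real.pi / (2 * ε)) := by
    rw [h3, Complex.norm_cpow_eq_rpow_re_of_pos (by positivity), Real.sqrt_eq_rpow]
    norm_num
  -- The real part of the exponent of each one-dimensional Gaussian integral.
  have h5 : ∀ p q : ℝ, ((-ε * p ^ 2 : ℂ) - (-2 * ε * p + I * (c * q)) ^ 2 / (4 * (-2 * ε))).re =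
      -ε * p ^ 2 / 2 - c ^ 2 * q ^ 2 / (8 * ε) := by
    intro p q
    have : ((-ε * p ^ 2 : ℂ) - (-2 * ε * p + I * (c * q)) ^ 2 / (4 * (-2 * ε))) =
        ((-ε * p ^ 2 / 2 - c ^ 2 * q ^ 2 / (8 * ε) : ℝ) : ℂ) + ((-c * p * q / 2 : ℝ) : ℂ) * I := by
      have hε' : (ε : ℂ) ≠ 0 := by exact_mod_cast hε.ne'
      push_cast
      field_simp
      ring_nf
      rw [Complex.I_sq]
      ring
    rw [this]
    simp only [Complex.add_re, Complex.ofReal_re, Complex.re_ofReal_mul, Complex.I_re, mul_zero,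
      add_zero]
  have h6 := h5 r.1 r.2
  have h7 := h5 r.2 (-r.1)
  rw [Complex.ofReal_neg, mul_neg, mul_neg, ← sub_eq_add_neg] at h7
  rw [h4, h6, h7]
  have h8 : ∀ a x y : ℝ, 0 ≤ a → Real.sqrt a * x * (Real.sqrt a * y) = a * (x * y) := by
    intro a x y ha
    calc _ = (Real.sqrt a * Real.sqrt a) * (x * y) := by ring
      _ = _ := by rw [Real.mul_self_sqrt ha]
  rw [h8 _ _ _ (by positivity), planeGaussian, ← Real.exp_add, ← Real.exp_add]
  congr 2
  field_simp
  ring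

variable {E : Type*} [NormedAddCommGroup E] [InnerProductSpace ℂ E]

theorem integrable_modGaussian_smul {ε : ℝ} (hε : 0 < ε) (ξ : ℝ × ℝ) {η : ℝ × ℝ → E}
    (hη : Continuous η) {M : ℝ} (hM : ∀ s, ‖η s‖ ≤ M) :
    Integrable fun s => modGaussian ε ξ s • η s := by
  refine ((integrable_planeGaussian hε).mul_const M).mono'
    ((continuous_modGaussian ε ξ).smul hη).aestronglyMeasurable
    (Filter.Eventually.of_forall fun s => ?_)
  rw [norm_smul, norm_modGaussian]
  exact mul_le_mul_of_nonneg_left (hM s) (planeGaussian_pos _ _).le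

/-- If the Gram kernel of a continuous map `η` from the plane to a Hilbert space is translation
invariant up to the symplectic phase `exp (i c (s₁ t₂ - s₂ t₁))`, then the Gaussian regularisations
of the Fourier integrals of `η` are bounded uniformly in the regularisation parameter. -/
theorem norm_integral_modGaussian_smul_le [CompleteSpace E] {c : ℝ} (hc : c ≠ 0)
    {η : ℝ × ℝ → E} (hη : Continuous η)
    (hinner : ∀ s t, ⟪η s, η t⟫_ℂ =
      Complex.exp (I * (c * (s.1 * t.2 - s.2 * t.1) : ℝ)) * ⟪η 0, η (t - s)⟫_ℂ)
    {ε : ℝ} (hε : 0 < ε) (ξ : ℝ × ℝ) :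
    ‖∫ s, modGaussian ε ξ s • η s‖ ≤ 2 * Real.pi / |c| * ‖η 0‖ := by
  have hnorm : ∀ s, ‖η s‖ = ‖η 0‖ := by
    intro s
    have h := hinner s s
    have h0 : s.1 * s.2 - s.2 * s.1 = 0 := by ring
    rw [h0, sub_self, inner_self_eq_norm_sq_to_K, inner_self_eq_norm_sq_to_K] at h
    simp only [mul_zero, Complex.ofReal_zero, Complex.exp_zero, one_mul,
      Complex.coe_algebraMap] at h
    have h' : ‖η s‖ ^ 2 = ‖η 0‖ ^ 2 := by exact_mod_cast h
    exact (sq_eq_sq₀ (norm_nonneg _) (norm_nonneg _)).1 h'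
  have hint := integrable_modGaussian_smul hε ξ hη fun s => (hnorm s).le
  set X := ∫ s, modGaussian ε ξ s • η s with hX
  -- After the substitution `t = s + r`, the integrand of `‖X‖²` has these values.
  let F : (ℝ × ℝ) × (ℝ × ℝ) → ℂ := fun p => (Complex.exp (I * (ξ.1 * p.2.1 + ξ.2 * p.2.2 : ℝ)) *
    ⟪η 0, η p.2⟫_ℂ) * ((planeGaussian ε p.1 * planeGaussian ε (p.1 + p.2) : ℂ) *
      Complex.exp (I * (c * (p.1.1 * p.2.2 - p.1.2 * p.2.1) : ℝ)))
  have hXX : ⟪X, X⟫_ℂ = ∫ s, ∫ r, F (s, r) := by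
    have h1 : ⟪X, X⟫_ℂ = ∫ s, ⟪modGaussian ε ξ s • η s, X⟫_ℂ := by
      rw [← inner_conj_symm, hX, ← integral_inner hint, ← integral_conj]
      simp only [inner_conj_symm]
    rw [h1]
    congr 1
    ext s
    rw [hX, ← integral_inner hint, ← integral_add_left_eq_self _ s]
    congr 1
    ext r
    rw [inner_smul_left, inner_smul_right, hinner, add_sub_cancel_left]
    simp only [modGaussian, F, map_mul, Complex.conj_ofReal, ← Complex.exp_conj, Prod.fst_add,
      Prod.snd_add, Complex.conj_I]
    have e : Complex.exp (-I * (ξ.1 * s.1 + ξ.2 * s.2 : ℝ)) *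
        Complex.exp (I * (ξ.1 * (s.1 + r.1) + ξ.2 * (s.2 + r.2) : ℝ)) =
        Complex.exp (I * (ξ.1 * r.1 + ξ.2 * r.2 : ℝ)) := by
      rw [← Complex.exp_add]
      congr 1
      push_cast
      ring
    have e2 : c * (s.1 * (s.2 + r.2) - s.2 * (s.1 + r.1)) = c * (s.1 * r.2 - s.2 * r.1) := by ring
    rw [← e, e2]
    ring
  have hFnorm : ∀ p, ‖F p‖ =
      ‖⟪η 0, η p.2⟫_ℂ‖ * (planeGaussian ε p.1 * planeGaussian ε (p.1 + p.2)) := by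
    intro p
    simp only [F, norm_mul, mul_comm I, Complex.norm_exp_ofReal_mul_I, Complex.norm_real,
      Real.norm_of_nonneg (planeGaussian_pos _ _).le, mul_one, one_mul]
  have hin : ∀ r, ‖⟪η 0, η r⟫_ℂ‖ ≤ ‖η 0‖ ^ 2 := fun r =>
    (norm_inner_le_norm _ _).trans_eq (by rw [hnorm r, sq])
  have hF : Integrable F := by
    have hb := ((integrable_planeGaussian (ε := ε / 3) (by positivity)).mul_prod
      (integrable_planeGaussian (ε := ε / 3) (by positivity))).const_mul (‖η 0‖ ^ 2)
    refine hb.mono' ?_ (Filter.Eventually.of_forall fun p => ?_)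
    · have : Continuous F := by
        simp only [F]
        fun_prop
      exact this.aestronglyMeasurable
    · rw [hFnorm]
      exact mul_le_mul (hin _) (planeGaussian_mul_le hε _ _)
        (mul_nonneg (planeGaussian_pos _ _).le (planeGaussian_pos _ _).le) (by positivity)
  set b := ε / 2 + c ^ 2 / (8 * ε) with hb
  have hb0 : 0 < b := by positivity
  have hXX2 : ‖X‖ ^ 2 ≤ 4 * Real.pi ^ 2 / c ^ 2 * ‖η 0‖ ^ 2 := by
    have h1 : ‖X‖ ^ 2 = ‖⟪X, X⟫_ℂ‖ := by
      rw [inner_self_eq_norm_sq_to_K, norm_pow]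
      simp
    have h2 : ⟪X, X⟫_ℂ = ∫ r, ∫ s, F (s, r) := by
      rw [hXX]
      exact integral_integral_swap hF
    rw [h1, h2]
    have h3 : ∀ r, ‖∫ s, F (s, r)‖ ≤ ‖η 0‖ ^ 2 * (Real.pi / (2 * ε)) * planeGaussian b r := by
      intro r
      simp only [F]
      rw [integral_const_mul, norm_mul, norm_integral_twisted_gaussian hε, norm_mul, mul_comm I,
        Complex.norm_exp_ofReal_mul_I, one_mul, mul_assoc]
      exact mul_le_mul_of_nonneg_right (hin r)
        (mul_nonneg (by positivity) (planeGaussian_pos _ _).le)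
    refine (norm_integral_le_of_norm_le ((integrable_planeGaussian hb0).const_mul _)
      (Filter.Eventually.of_forall h3)).trans ?_
    rw [integral_const_mul, integral_planeGaussian hb0, mul_assoc, mul_comm (‖η 0‖ ^ 2)]
    refine mul_le_mul_of_nonneg_right ?_ (by positivity)
    -- The growth of `π / (2 ε)` is compensated by the term `c² / (8 ε)` of `b`.
    have h4 : Real.pi / (2 * ε) * (Real.pi / b) = 4 * Real.pi ^ 2 / (4 * ε ^ 2 + c ^ 2) := by
      rw [hb]
      field_simp
      ring
    rw [h4]
    have : 0 < c ^ 2 := by positivity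
    gcongr
    nlinarith [sq_nonneg ε]
  have h5 : 4 * Real.pi ^ 2 / c ^ 2 * ‖η 0‖ ^ 2 = (2 * Real.pi / |c| * ‖η 0‖) ^ 2 := by
    rw [mul_pow, div_pow, sq_abs]
    ring
  rw [h5] at hXX2
  exact (sq_le_sq₀ (norm_nonneg _) (by positivity)).1 hXX2

end TwistedOrbits

/-! ### Matrix coefficients of the Weyl operators -/

section Coefficients

variable {H : Type u} [NormedAddCommGroup H] [InnerProductSpace ℝ H] (h₁ h₂ : H)

/-- The matrix coefficient `s ↦ ⟪x, exp (i s₁ P(h₁) + i s₂ Q(h₂)) y⟫`. -/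
def weylCoeff (x y : Fock (Cplx H)) (s : ℝ × ℝ) : ℂ := ⟪x, planeWeyl h₁ h₂ s y⟫_ℂ

@[fun_prop]
theorem continuous_weylCoeff (x y : Fock (Cplx H)) : Continuous (weylCoeff h₁ h₂ x y) :=
  continuous_const.inner (continuous_planeWeyl_apply h₁ h₂ y)

theorem norm_weylCoeff_le (x y : Fock (Cplx H)) (s : ℝ × ℝ) :
    ‖weylCoeff h₁ h₂ x y s‖ ≤ ‖x‖ * ‖y‖ := by
  refine (norm_inner_le_norm _ _).trans_eq ?_
  rw [norm_planeWeyl_apply]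

theorem planeWeyl_zero (x : Fock (Cplx H)) : planeWeyl h₁ h₂ 0 x = x := by
  have h : Cplx.mk ((0 : ℝ × ℝ).1 • h₁) ((0 : ℝ × ℝ).2 • h₂) = 0 := by
    apply Cplx.ext <;> simp
  rw [planeWeyl, h, weyl_zero]

theorem weylCoeff_neg (x y : Fock (Cplx H)) (s : ℝ × ℝ) :
    weylCoeff h₁ h₂ x y (-s) = starRingEnd ℂ (weylCoeff h₁ h₂ y x s) := by
  rw [weylCoeff, weylCoeff, ← inner_planeWeyl_left, inner_conj_symm]

variable {h₁ h₂}

theorem norm_integral_modGaussian_mul_weylCoeff_le (hh : ⟪h₁, h₂⟫_ℝ ≠ 0)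
    (x y : Fock (Cplx H)) {ε : ℝ} (hε : 0 < ε) (ξ : ℝ × ℝ) :
    ‖∫ s, modGaussian ε ξ s * weylCoeff h₁ h₂ x y s‖ ≤
      2 * Real.pi / |⟪h₁, h₂⟫_ℝ| * (‖x‖ * ‖y‖) := by
  have hc := continuous_planeWeyl_apply h₁ h₂ y
  have h1 := norm_integral_modGaussian_smul_le hh hc (fun s t => by
    rw [inner_planeWeyl_planeWeyl, planeWeyl_zero]) hε ξ
  have h2 := integrable_modGaussian_smul hε ξ hc fun s => (norm_planeWeyl_apply h₁ h₂ s y).le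
  have h3 : ∫ s, modGaussian ε ξ s * weylCoeff h₁ h₂ x y s =
      ⟪x, ∫ s, modGaussian ε ξ s • planeWeyl h₁ h₂ s y⟫_ℂ := by
    rw [← integral_inner h2]
    simp only [inner_smul_right, weylCoeff]
  rw [h3]
  refine (norm_inner_le_norm _ _).trans ?_
  rw [planeWeyl_zero] at h1
  calc ‖x‖ * _ ≤ ‖x‖ * (2 * Real.pi / |⟪h₁, h₂⟫_ℝ| * ‖y‖) := by gcongr
    _ = _ := by ring

/-- The regularised `L²` bound for matrix coefficients. The function `|⟪x, U(s) y⟫|²` is a matrix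
coefficient of `s ↦ U(s) ⊗ U(-s)`, whose phase is that of `U` with `c` replaced by `2 c`, so that
the uniform bound for Gaussian regularisations applies in the tensor square of Fock space. -/
theorem integral_planeGaussian_mul_norm_weylCoeff_sq_le (hh : ⟪h₁, h₂⟫_ℝ ≠ 0)
    (x y : Fock (Cplx H)) {ε : ℝ} (hε : 0 < ε) :
    ∫ s, planeGaussian ε s * ‖weylCoeff h₁ h₂ x y s‖ ^ 2 ≤
      2 * Real.pi / |2 * ⟪h₁, h₂⟫_ℝ| * (‖x‖ * ‖y‖) ^ 2 := by
  let E := UniformSpace.Completion (Fock (Cplx H) ⊗[ℂ] Fock (Cplx H))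
  let η : ℝ × ℝ → E := fun s =>
    ((planeWeyl h₁ h₂ s y ⊗ₜ[ℂ] planeWeyl h₁ h₂ (-s) x : Fock (Cplx H) ⊗[ℂ] Fock (Cplx H)) : E)
  have htmul : ∀ a b a' b' : Fock (Cplx H),
      ⟪((a ⊗ₜ[ℂ] b : Fock (Cplx H) ⊗[ℂ] Fock (Cplx H)) : E),
        ((a' ⊗ₜ[ℂ] b' : Fock (Cplx H) ⊗[ℂ] Fock (Cplx H)) : E)⟫_ℂ = ⟪a, a'⟫_ℂ * ⟪b, b'⟫_ℂ :=
    fun a b a' b' => (UniformSpace.Completion.inner_coe _ _).trans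
      (TensorProduct.inner_tmul (𝕜 := ℂ) a a' b b')
  have hη : Continuous η := by
    have hA := continuous_planeWeyl_apply h₁ h₂ y
    have hB := (continuous_planeWeyl_apply h₁ h₂ x).comp continuous_neg
    exact (UniformSpace.Completion.continuous_coe _).comp
      ((TensorProduct.continuous_tmul (𝕜 := ℂ)).comp (hA.prodMk hB))
  have hη0 : η 0 = ((y ⊗ₜ[ℂ] x : Fock (Cplx H) ⊗[ℂ] Fock (Cplx H)) : E) := by
    simp only [η, neg_zero, planeWeyl_zero]
  have hη0' : ‖η 0‖ = ‖x‖ * ‖y‖ := by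
    rw [hη0, UniformSpace.Completion.norm_coe, TensorProduct.norm_tmul, mul_comm]
  have hinner : ∀ s t, ⟪η s, η t⟫_ℂ =
      Complex.exp (I * (2 * ⟪h₁, h₂⟫_ℝ * (s.1 * t.2 - s.2 * t.1) : ℝ)) * ⟪η 0, η (t - s)⟫_ℂ := by
    intro s t
    rw [hη0]
    simp only [η, htmul, inner_planeWeyl_planeWeyl]
    rw [neg_sub_neg, neg_sub, mul_mul_mul_comm, ← Complex.exp_add]
    congr 2
    simp only [Prod.fst_neg, Prod.snd_neg]
    push_cast
    ring
  have h1 := norm_integral_modGaussian_smul_le (mul_ne_zero two_ne_zero hh) hη hinner hε 0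
  have hM : ∀ s, ‖η s‖ ≤ ‖x‖ * ‖y‖ := by
    intro s
    rw [UniformSpace.Completion.norm_coe, TensorProduct.norm_tmul, norm_planeWeyl_apply,
      norm_planeWeyl_apply, mul_comm]
  have h2 := integrable_modGaussian_smul hε 0 hη hM
  let ζ : E := ((x ⊗ₜ[ℂ] y : Fock (Cplx H) ⊗[ℂ] Fock (Cplx H)) : E)
  have hζ : ‖ζ‖ = ‖x‖ * ‖y‖ := by
    rw [UniformSpace.Completion.norm_coe, TensorProduct.norm_tmul]
  have h3 : ⟪ζ, ∫ s, modGaussian ε 0 s • η s⟫_ℂ =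
      ((∫ s, planeGaussian ε s * ‖weylCoeff h₁ h₂ x y s‖ ^ 2 : ℝ) : ℂ) := by
    rw [← integral_inner h2, ← integral_complex_ofReal]
    congr 1
    ext s
    have h4 : ⟪ζ, η s⟫_ℂ = ((‖weylCoeff h₁ h₂ x y s‖ ^ 2 : ℝ) : ℂ) := by
      simp only [η, ζ, htmul]
      have h5 := weylCoeff_neg h₁ h₂ y x s
      rw [weylCoeff] at h5
      rw [h5, Complex.ofReal_pow, ← Complex.mul_conj']
      rfl
    rw [inner_smul_right, h4]
    simp [modGaussian]
  have h6 := norm_inner_le_norm (𝕜 := ℂ) ζ (∫ s, modGaussian ε 0 s • η s)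
  rw [h3, Complex.norm_real, hζ] at h6
  refine (le_abs_self _).trans (h6.trans ?_)
  rw [hη0'] at h1
  calc _ ≤ ‖x‖ * ‖y‖ * (2 * Real.pi / |2 * ⟪h₁, h₂⟫_ℝ| * (‖x‖ * ‖y‖)) := by gcongr
    _ = _ := by ring

/-- Matrix coefficients are square integrable, by Fatou's lemma along `ε = 1 / (n + 1)`. -/
theorem memLp_two_weylCoeff (hh : ⟪h₁, h₂⟫_ℝ ≠ 0) (x y : Fock (Cplx H)) :
    MemLp (weylCoeff h₁ h₂ x y) 2 := by
  have hcont := continuous_weylCoeff h₁ h₂ x y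
  rw [memLp_two_iff_integrable_sq_norm hcont.aestronglyMeasurable]
  refine ⟨(by fun_prop : Continuous _).aestronglyMeasurable, ?_⟩
  rw [hasFiniteIntegral_iff_ofReal (Filter.Eventually.of_forall fun s => by positivity)]
  set C := 2 * Real.pi / |2 * ⟪h₁, h₂⟫_ℝ| * (‖x‖ * ‖y‖) ^ 2
  have hε : ∀ n : ℕ, (0 : ℝ) < 1 / ((n : ℝ) + 1) := fun n => by positivity
  have hlim : ∀ s, Filter.Tendsto (fun n : ℕ => ENNReal.ofReal
      (planeGaussian (1 / ((n : ℝ) + 1)) s * ‖weylCoeff h₁ h₂ x y s‖ ^ 2)) Filter.atTop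
      (nhds (ENNReal.ofReal (‖weylCoeff h₁ h₂ x y s‖ ^ 2))) := by
    intro s
    apply (ENNReal.continuous_ofReal.tendsto _).comp
    have h0 : Continuous fun ε : ℝ => planeGaussian ε s * ‖weylCoeff h₁ h₂ x y s‖ ^ 2 := by
      unfold planeGaussian
      fun_prop
    have h1 := (h0.tendsto 0).comp (tendsto_one_div_add_atTop_nhds_zero_nat (𝕜 := ℝ))
    simpa [planeGaussian] using! h1
  refine lt_of_le_of_lt (b := ENNReal.ofReal C) ?_ ENNReal.ofReal_lt_top
  calc ∫⁻ s, ENNReal.ofReal (‖weylCoeff h₁ h₂ x y s‖ ^ 2)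
      = ∫⁻ s, Filter.liminf (fun n : ℕ => ENNReal.ofReal
        (planeGaussian (1 / ((n : ℝ) + 1)) s * ‖weylCoeff h₁ h₂ x y s‖ ^ 2)) Filter.atTop := by
        congr 1
        ext s
        exact (hlim s).liminf_eq.symm
    _ ≤ Filter.liminf (fun n : ℕ => ∫⁻ s, ENNReal.ofReal
        (planeGaussian (1 / ((n : ℝ) + 1)) s * ‖weylCoeff h₁ h₂ x y s‖ ^ 2)) Filter.atTop :=
        lintegral_liminf_le fun n => by fun_prop
    _ ≤ Filter.liminf (fun _ : ℕ => ENNReal.ofReal C) Filter.atTop := by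
        refine Filter.liminf_le_liminf (Filter.Eventually.of_forall fun n => ?_)
        rw [← ofReal_integral_eq_lintegral_ofReal]
        · exact ENNReal.ofReal_le_ofReal
            (integral_planeGaussian_mul_norm_weylCoeff_sq_le hh x y (hε n))
        · refine ((integrable_planeGaussian (hε n)).mul_const ((‖x‖ * ‖y‖) ^ 2)).mono'
            (by fun_prop : Continuous _).aestronglyMeasurable
            (Filter.Eventually.of_forall fun s => ?_)
          have hp := (planeGaussian_pos (1 / ((n : ℝ) + 1)) s).le
          rw [Real.norm_of_nonneg (mul_nonneg hp (by positivity))]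
          exact mul_le_mul_of_nonneg_left
            (pow_le_pow_left₀ (norm_nonneg _) (norm_weylCoeff_le h₁ h₂ x y s) 2) hp
        · exact Filter.Eventually.of_forall fun s =>
            mul_nonneg (planeGaussian_pos _ _).le (by positivity)
    _ = ENNReal.ofReal C := Filter.liminf_const _

end Coefficients

/-! ### Fourier transforms of functions on the plane -/

section PlaneFourier

open scoped FourierTransform

/-- The Euclidean plane: `ℝ × ℝ` with the `L²` norm, on which Mathlib's Fourier transform lives. -/
abbrev EPlane : Type := WithLp 2 (ℝ × ℝ)

/-- A Schwartz function on `ℝ × ℝ`, regarded as a Schwartz function on the Euclidean plane. -/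
def toEPlane (φ : 𝓢(ℝ × ℝ, ℂ)) : 𝓢(EPlane, ℂ) :=
  SchwartzMap.compCLMOfContinuousLinearEquiv ℂ (WithLp.prodContinuousLinearEquiv 2 ℝ ℝ ℝ) φ

theorem toEPlane_apply (φ : 𝓢(ℝ × ℝ, ℂ)) (x : EPlane) : toEPlane φ x = φ (WithLp.ofLp x) := rfl

theorem integral_comp_ofLp {E : Type*} [NormedAddCommGroup E] [NormedSpace ℝ E] (f : ℝ × ℝ → E) :
    ∫ x : EPlane, f (WithLp.ofLp x) = ∫ z, f z :=
  (WithLp.volume_preserving_symm_measurableEquiv_toLp_prod ℝ ℝ).integral_comp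
    (MeasurableEquiv.toLp 2 (ℝ × ℝ)).symm.measurableEmbedding f

theorem integral_comp_two_pi_smul (f : ℝ × ℝ → ℂ) :
    ∫ z, f ((2 * Real.pi) • z) = (1 / (2 * Real.pi) : ℂ) ^ 2 * ∫ z, f z := by
  rw [Measure.integral_comp_smul]
  have h : Module.finrank ℝ (ℝ × ℝ) = 2 := by simp
  rw [h, abs_of_nonneg (by positivity), Complex.real_smul]
  push_cast
  ring

/-- Comparison of the normalisations `∫ φ(z) exp (-2πi z·x) dz` and `invFourier`. -/
theorem fourier_toEPlane (φ : 𝓢(ℝ × ℝ, ℂ)) (x : EPlane) :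
    (𝓕 (toEPlane φ)) x = 2 * Real.pi * invFourier φ ((2 * Real.pi) • WithLp.ofLp x) := by
  have hpi : (Real.pi : ℂ) ≠ 0 := by exact_mod_cast Real.pi_ne_zero
  rw [SchwartzMap.fourier_coe, Real.fourier_eq', invFourier, ← mul_assoc,
    mul_one_div_cancel (by simp), one_mul, ← integral_comp_ofLp]
  congr 1
  ext v
  rw [smul_eq_mul, mul_comm, toEPlane_apply, WithLp.prod_inner_apply]
  congr 2
  simp only [RCLike.inner_apply, conj_trivial, Prod.smul_fst, Prod.smul_snd, smul_eq_mul]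
  push_cast
  ring

theorem integrable_invFourier (φ : 𝓢(ℝ × ℝ, ℂ)) : Integrable (invFourier φ) := by
  have h1 : Integrable fun x : EPlane =>
      2 * Real.pi * invFourier φ ((2 * Real.pi) • WithLp.ofLp x) := by
    simp_rw [← fourier_toEPlane]
    exact (𝓕 (toEPlane φ)).integrable
  have h2 : Integrable fun z : ℝ × ℝ =>
      2 * Real.pi * invFourier φ ((2 * Real.pi) • z) :=
    ((WithLp.volume_preserving_symm_measurableEquiv_toLp_prod ℝ ℝ).integrable_comp_emb
      (MeasurableEquiv.toLp 2 (ℝ × ℝ)).symm.measurableEmbedding).1 h1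
  have hpi : (2 * Real.pi : ℂ) ≠ 0 := by simp
  have h3 := (h2.const_mul (2 * Real.pi : ℂ)⁻¹)
  simp only [← mul_assoc, inv_mul_cancel₀ hpi, one_mul] at h3
  exact (integrable_comp_smul_iff volume _ (by positivity)).1 h3

/-- `W` is the Fourier transform of `B`, in the normalisation of the Wigner density of a state with
characteristic function `B`, tested against Schwartz functions. -/
def IsWeylFourier (B W : ℝ × ℝ → ℂ) : Prop :=
  ∀ φ : 𝓢(ℝ × ℝ, ℂ), ∫ z, φ z * W z = (1 / (2 * Real.pi) : ℂ) * ∫ s, B s * invFourier φ s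

/-- Plancherel's theorem provides the Fourier transform of a square integrable function. -/
theorem exists_isWeylFourier {B : ℝ × ℝ → ℂ} (hB : MemLp B 2) :
    ∃ W : ℝ × ℝ → ℂ, MemLp W 2 ∧ IsWeylFourier B W := by
  have hmp := WithLp.volume_preserving_symm_measurableEquiv_toLp_prod ℝ ℝ
  have hpi : (0 : ℝ) < 2 * Real.pi := by positivity
  have hb : MemLp (fun x : EPlane => B ((2 * Real.pi) • WithLp.ofLp x)) 2 := by
    have h1 : MemLp (fun z : ℝ × ℝ => B ((2 * Real.pi) • z)) 2 := by
      have h2 : MemLp B 2 (Measure.map (fun z : ℝ × ℝ => (2 * Real.pi) • z) volume) := by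
        rw [Measure.map_addHaar_smul volume hpi.ne']
        exact hB.smul_measure ENNReal.ofReal_ne_top
      exact h2.comp_of_map (measurable_const_smul _).aemeasurable
    exact h1.comp_measurePreserving hmp
  -- The density is the `L²` Fourier transform of `x ↦ B (2 π x)`.
  let f : Lp ℂ 2 (volume : Measure EPlane) := hb.toLp _
  let g : Lp ℂ 2 (volume : Measure EPlane) := 𝓕 f
  refine ⟨fun z => g (WithLp.toLp 2 z), ?_, fun φ => ?_⟩
  · exact (Lp.memLp g).comp_measurePreserving (WithLp.volume_preserving_toLp ℝ ℝ)
  · have h1 := congrArg (fun T => T (toEPlane φ)) (Lp.fourier_toTemperedDistribution_eq f)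
    simp only [TemperedDistribution.fourier_apply, Lp.toTemperedDistribution_apply] at h1
    have h2 : ∫ z, φ z * g (WithLp.toLp 2 z) = ∫ x : EPlane, toEPlane φ x • g x :=
      (integral_comp_ofLp fun z => φ z * g (WithLp.toLp 2 z)).symm
    have h3 : ∫ x : EPlane, (𝓕 (toEPlane φ)) x • f x =
        ∫ x : EPlane, (2 * Real.pi * invFourier φ ((2 * Real.pi) • WithLp.ofLp x)) *
          B ((2 * Real.pi) • WithLp.ofLp x) := by
      refine integral_congr_ae ?_
      filter_upwards [hb.coeFn_toLp] with x hx
      rw [fourier_toEPlane, smul_eq_mul, hx]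
    rw [h2, ← h1, h3, integral_comp_ofLp fun z => (2 * Real.pi * invFourier φ ((2 * Real.pi) • z)) *
      B ((2 * Real.pi) • z),
      integral_comp_two_pi_smul fun z => (2 * Real.pi * invFourier φ z) * B z]
    have h4 : ∀ z, (2 * Real.pi * invFourier φ z) * B z =
        (2 * Real.pi : ℂ) * (B z * invFourier φ z) := fun z => by ring
    simp_rw [h4]
    rw [integral_const_mul, ← mul_assoc]
    congr 1
    have hpi : (Real.pi : ℂ) ≠ 0 := by exact_mod_cast Real.pi_ne_zero
    field_simp

/-- If the Gaussian regularisations of the Fourier integral of `B` are uniformly bounded, then so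
is, in the sense of distributions, its Fourier transform. -/
theorem IsWeylFourier.norm_integral_le {B W : ℝ × ℝ → ℂ} (hW : IsWeylFourier B W)
    (hBc : Continuous B) {M C : ℝ} (hM : ∀ s, ‖B s‖ ≤ M)
    (hC : ∀ ε > 0, ∀ ξ, ‖∫ s, modGaussian ε ξ s * B s‖ ≤ C) (φ : 𝓢(ℝ × ℝ, ℂ)) :
    ‖∫ z, φ z * W z‖ ≤ (1 / (2 * Real.pi)) ^ 2 * (C * ∫ z, ‖φ z‖) := by
  rw [hW φ]
  have hφ : Integrable φ := φ.integrable
  have hM0 : 0 ≤ M := (norm_nonneg _).trans (hM 0)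
  let ε : ℕ → ℝ := fun n => 1 / ((n : ℝ) + 1)
  have hε : ∀ n, 0 < ε n := fun n => by positivity
  have hG1 : ∀ {e : ℝ} (_ : 0 < e) s, planeGaussian e s ≤ 1 := fun {e} he s => by
    rw [planeGaussian, ← Real.exp_add, Real.exp_le_one_iff]
    nlinarith [mul_nonneg he.le (sq_nonneg s.1), mul_nonneg he.le (sq_nonneg s.2)]
  have hlim : Filter.Tendsto (fun n => (1 / (2 * Real.pi) : ℂ) *
      ∫ s, planeGaussian (ε n) s * (B s * invFourier φ s)) Filter.atTop
      (nhds ((1 / (2 * Real.pi) : ℂ) * ∫ s, B s * invFourier φ s)) := by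
    refine Filter.Tendsto.const_mul _ ?_
    refine tendsto_integral_of_dominated_convergence (fun s => M * ‖invFourier φ s‖) (fun n => ?_)
      ((integrable_invFourier φ).norm.const_mul M)
      (fun n => Filter.Eventually.of_forall fun s => ?_)
      (Filter.Eventually.of_forall fun s => ?_)
    · exact ((by fun_prop : Continuous fun s =>
        (planeGaussian (ε n) s : ℂ)).aestronglyMeasurable).mul
        (hBc.aestronglyMeasurable.mul (integrable_invFourier φ).aestronglyMeasurable)
    · rw [norm_mul, norm_mul, Complex.norm_real, Real.norm_of_nonneg (planeGaussian_pos _ _).le]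
      calc _ ≤ 1 * (M * ‖invFourier φ s‖) := by
            gcongr
            · exact hG1 (hε n) s
            · exact hM s
        _ = _ := one_mul _
    · have h0 : Continuous fun e : ℝ => (planeGaussian e s : ℂ) * (B s * invFourier φ s) := by
        unfold planeGaussian
        fun_prop
      have h1 := (h0.tendsto 0).comp (tendsto_one_div_add_atTop_nhds_zero_nat (𝕜 := ℝ))
      have h2 : (planeGaussian 0 s : ℂ) * (B s * invFourier φ s) = B s * invFourier φ s := by
        simp [planeGaussian]
      rw [h2] at h1
      exact h1
  refine le_of_tendsto hlim.norm (Filter.Eventually.of_forall fun n => ?_)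
  have hcalc : (1 / (2 * Real.pi) : ℂ) * ∫ s, planeGaussian (ε n) s * (B s * invFourier φ s) =
      (1 / (2 * Real.pi) : ℂ) ^ 2 * ∫ z, φ z * ∫ s, modGaussian (ε n) (-z) s * B s := by
    have h1 : ∀ s, planeGaussian (ε n) s * (B s * invFourier φ s) = (1 / (2 * Real.pi) : ℂ) *
        ∫ z, φ z * (modGaussian (ε n) (-z) s * B s) := by
      intro s
      rw [invFourier, mul_left_comm (B s), mul_left_comm, ← integral_const_mul,
        ← integral_const_mul]
      congr 2
      ext z
      rw [modGaussian]
      have e : Complex.exp (I * ((-z).1 * s.1 + (-z).2 * s.2 : ℝ)) =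
          Complex.exp (-I * (s.1 * z.1 + s.2 * z.2 : ℝ)) := by
        congr 1
        simp only [Prod.fst_neg, Prod.snd_neg]
        push_cast
        ring
      rw [e]
      ring
    simp_rw [h1]
    rw [integral_const_mul, ← mul_assoc, ← sq]
    congr 1
    simp_rw [← integral_const_mul]
    refine integral_integral_swap ?_
    have hb := ((integrable_planeGaussian (hε n)).mul_const M).mul_prod hφ.norm
    refine hb.mono' ?_ (Filter.Eventually.of_forall fun p => ?_)
    · have hc : Continuous fun p : (ℝ × ℝ) × (ℝ × ℝ) =>
          φ p.2 * (modGaussian (ε n) (-p.2) p.1 * B p.1) := by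
        have := φ.continuous
        unfold modGaussian
        fun_prop
      exact hc.aestronglyMeasurable
    · simp only [Function.uncurry]
      rw [norm_mul, norm_mul, norm_modGaussian, mul_comm]
      exact mul_le_mul_of_nonneg_right (mul_le_mul_of_nonneg_left (hM _) (planeGaussian_pos _ _).le)
        (norm_nonneg _)
  rw [hcalc, norm_mul, norm_pow]
  have hn : ‖(1 / (2 * Real.pi) : ℂ)‖ = 1 / (2 * Real.pi) := by
    simp [abs_of_pos Real.pi_pos]
  rw [hn]
  refine mul_le_mul_of_nonneg_left ?_ (by positivity)
  rw [← integral_const_mul]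
  refine norm_integral_le_of_norm_le (hφ.norm.const_mul C) (Filter.Eventually.of_forall fun z => ?_)
  rw [norm_mul, mul_comm]
  exact mul_le_mul_of_nonneg_right (hC _ (hε n) _) (norm_nonneg _)

/-- A locally integrable function whose integrals against Schwartz functions `φ` are bounded by a
multiple of `‖φ‖₁` is essentially bounded, by Lebesgue differentiation along bump functions. -/
theorem ae_norm_le_of_norm_integral_le {W : ℝ × ℝ → ℂ} (hW : LocallyIntegrable W) {C : ℝ}
    (h : ∀ φ : 𝓢(ℝ × ℝ, ℂ), ‖∫ z, φ z * W z‖ ≤ C * ∫ z, ‖φ z‖) : ∀ᵐ z, ‖W z‖ ≤ C := by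
  let φ : ℕ → ContDiffBump (0 : ℝ × ℝ) := fun n =>
    ⟨1 / ((n : ℝ) + 1), 2 * (1 / ((n : ℝ) + 1)), by positivity, by
      have : 0 < 1 / ((n : ℝ) + 1) := by positivity
      linarith⟩
  have hφ : Filter.Tendsto (fun n => (φ n).rOut) Filter.atTop (nhds 0) := by
    have := (tendsto_one_div_add_atTop_nhds_zero_nat (𝕜 := ℝ)).const_mul 2
    simpa [φ] using! this
  filter_upwards [ContDiffBump.ae_convolution_tendsto_right_of_locallyIntegrable hφ
    (K := 2) (Filter.Eventually.of_forall fun n => le_rfl) hW] with x hx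
  refine le_of_tendsto hx.norm (Filter.Eventually.of_forall fun n => ?_)
  rw [convolution_eq_swap]
  let ψ : ℝ × ℝ → ℂ := fun z => (((φ n).normed volume (x - z) : ℝ) : ℂ)
  have hs : HasCompactSupport ψ := by
    have h1 : HasCompactSupport fun z => (φ n).normed volume (x - z) :=
      (φ n).hasCompactSupport_normed.comp_homeomorph (Homeomorph.subLeft x)
    exact h1.comp_left (g := fun r : ℝ => (r : ℂ)) Complex.ofReal_zero
  have hd : ContDiff ℝ ((⊤ : ℕ∞) : WithTop ℕ∞) ψ :=
    Complex.ofRealCLM.contDiff.comp ((φ n).contDiff_normed.comp (contDiff_const.sub contDiff_id))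
  have h2 := h (hs.toSchwartzMap hd)
  have h3 : ∫ z, ‖(hs.toSchwartzMap hd) z‖ = 1 := by
    have h4 : ∀ z, ‖(hs.toSchwartzMap hd) z‖ = (φ n).normed volume (x - z) := by
      intro z
      change ‖(((φ n).normed volume (x - z) : ℝ) : ℂ)‖ = _
      rw [Complex.norm_real, Real.norm_of_nonneg ((φ n).nonneg_normed _)]
    simp_rw [h4]
    rw [integral_sub_left_eq_self (fun z => (φ n).normed volume z), (φ n).integral_normed]
  rw [h3, mul_one] at h2
  exact h2

theorem memLp_of_memLp_two_of_memLp_top {α E : Type*} [MeasurableSpace α] {μ : Measure α}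
    [NormedAddCommGroup E] {f : α → E} (h2 : MemLp f 2 μ) (h : MemLp f ∞ μ) {p : ℝ≥0∞}
    (hp : 2 ≤ p) : MemLp f p μ := by
  by_cases hpt : p = ∞
  · rwa [hpt]
  have hp0 : p ≠ 0 := (lt_of_lt_of_le (by norm_num) hp).ne'
  refine ⟨h2.1, (eLpNorm_lt_top_iff_lintegral_rpow_enorm_lt_top hp0 hpt).2 ?_⟩
  have h2' :=
    (eLpNorm_lt_top_iff_lintegral_rpow_enorm_lt_top two_ne_zero ENNReal.ofNat_ne_top).1 h2.2
  have hp2 : 2 ≤ p.toReal := by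
    have := ENNReal.toReal_mono hpt hp
    simpa using this
  set C := eLpNorm f ∞ μ with hC
  have hCt : C ^ (p.toReal - 2) ≠ ∞ := ENNReal.rpow_ne_top_of_nonneg (by linarith) h.2.ne
  refine lt_of_le_of_lt (b := C ^ (p.toReal - 2) * ∫⁻ a, ‖f a‖ₑ ^ (2 : ℝ≥0∞).toReal ∂μ) ?_
    (ENNReal.mul_lt_top (lt_top_iff_ne_top.2 hCt) h2')
  rw [← lintegral_const_mul' _ _ hCt]
  refine lintegral_mono_ae ?_
  filter_upwards [ae_le_eLpNormEssSup (f := f) (μ := μ)] with a ha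
  have e : p.toReal = (p.toReal - 2) + 2 := by ring
  calc ‖f a‖ₑ ^ p.toReal = ‖f a‖ₑ ^ (p.toReal - 2) * ‖f a‖ₑ ^ (2 : ℝ) := by
        conv_lhs => rw [e]
        exact ENNReal.rpow_add_of_nonneg _ _ (by linarith) (by norm_num)
    _ ≤ C ^ (p.toReal - 2) * ‖f a‖ₑ ^ (2 : ℝ≥0∞).toReal := by
        have h0 : (2 : ℝ≥0∞).toReal = 2 := by simp
        rw [h0]
        gcongr
        rw [hC, eLpNorm_exponent_top]
        exact ha

end PlaneFourier

/-! ### Annihilation and creation operators -/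

section Annihilation

variable {K : Type u} [NormedAddCommGroup K] [InnerProductSpace ℂ K]

/-- The closed subspace spanned by the pairs `(𝓔(f), ⟪k, f⟫ 𝓔(f))`, which is the graph of `a(k)`. -/
def annGraph (k : K) : Submodule ℂ (Fock K × Fock K) :=
  (Submodule.span ℂ (Set.range fun f : K => (expVec f, ⟪k, f⟫_ℂ • expVec f))).topologicalClosure

/-- Cauchy's estimate for the entire function `t ↦ ⟪𝓔(g + t̄ k), x⟫`, whose derivative at `0` is
`⟪𝓔(g), a(k) x⟫`, bounds the latter by a multiple of `‖x‖`. -/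
theorem norm_inner_expVec_annGraph_le (k g : K) {p : Fock K × Fock K} (hp : p ∈ annGraph k) :
    ‖⟪expVec g, p.2⟫_ℂ‖ ≤ Real.sqrt (Real.exp ((‖g‖ + ‖k‖) ^ 2)) * ‖p.1‖ := by
  set C := Real.sqrt (Real.exp ((‖g‖ + ‖k‖) ^ 2)) with hC
  have hclosed : IsClosed {p : Fock K × Fock K | ‖⟪expVec g, p.2⟫_ℂ‖ ≤ C * ‖p.1‖} :=
    isClosed_le (by fun_prop) (by fun_prop)
  refine closure_minimal (fun p hp => ?_) hclosed hp
  let F : Fock K × Fock K → ℂ → ℂ := fun p t => ⟪expVec (g + (starRingEnd ℂ t) • k), p.1⟫_ℂ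
  have key : Differentiable ℂ (F p) ∧ HasDerivAt (F p) ⟪expVec g, p.2⟫_ℂ 0 := by
    induction hp using Submodule.span_induction with
    | mem p hp =>
      obtain ⟨f, rfl⟩ := hp
      have hF : F (expVec f, ⟪k, f⟫_ℂ • expVec f) =
          fun t => Complex.exp (⟪g, f⟫_ℂ + t * ⟪k, f⟫_ℂ) := by
        ext t
        simp only [F]
        rw [inner_expVec, inner_add_left, inner_smul_left, Complex.conj_conj]
      rw [hF]
      refine ⟨by fun_prop, ?_⟩
      have h1 : HasDerivAt (fun t : ℂ => ⟪g, f⟫_ℂ + t * ⟪k, f⟫_ℂ) (1 * ⟪k, f⟫_ℂ) 0 :=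
        ((hasDerivAt_id (0 : ℂ)).mul_const _).const_add _
      have h2 := h1.cexp
      simp only [zero_mul, add_zero, one_mul] at h2
      rw [inner_smul_right, inner_expVec, mul_comm]
      exact h2
    | zero =>
      have hF : F 0 = fun _ => 0 := by
        ext t
        simp [F]
      rw [hF, Prod.snd_zero, inner_zero_right]
      exact ⟨differentiable_const _, hasDerivAt_const _ _⟩
    | add p q _ _ hp hq =>
      have hF : F (p + q) = F p + F q := by
        ext t
        simp only [F, Prod.fst_add, inner_add_right, Pi.add_apply]
      rw [hF, Prod.snd_add, inner_add_right]
      exact ⟨hp.1.add hq.1, hp.2.add hq.2⟩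
    | smul c p _ hp =>
      have hF : F (c • p) = c • F p := by
        ext t
        simp only [F, Prod.smul_fst, inner_smul_right, Pi.smul_apply, smul_eq_mul]
      rw [hF, Prod.smul_snd, inner_smul_right]
      exact ⟨hp.1.const_smul c, hp.2.const_smul c⟩
  change ‖⟪expVec g, p.2⟫_ℂ‖ ≤ C * ‖p.1‖
  rw [← key.2.deriv]
  have h := Complex.norm_deriv_le_of_forall_mem_sphere_norm_le (c := (0 : ℂ)) (R := 1)
    (C := C * ‖p.1‖) one_pos key.1.diffContOnCl fun t ht => by
      refine (norm_inner_le_norm _ _).trans ?_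
      gcongr
      rw [hC]
      apply Real.le_sqrt_of_sq_le
      rw [norm_expVec_sq]
      gcongr
      refine (norm_add_le _ _).trans ?_
      rw [norm_smul, RCLike.norm_conj, mem_sphere_zero_iff_norm.1 ht, one_mul]
  rwa [div_one] at h

/-- The span of the pairs `(𝓔(f), ⟪k, f⟫ 𝓔(f))` has the graph of an operator as its closure, so that
`annihilation k` is not the junk value of `Submodule.toLinearPMap`. -/
theorem graph_annihilation (k : K) : (annihilation k).graph = annGraph k := by
  refine Submodule.toLinearPMap_graph_eq _ fun p hp hp0 => ?_
  refine eq_zero_of_forall_inner_expVec _ fun g => ?_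
  have h := norm_inner_expVec_annGraph_le k g hp
  rw [hp0, norm_zero, mul_zero] at h
  exact norm_le_zero_iff.1 h

/-- Weyl operators shift annihilation operators by scalars. -/
theorem weyl_mem_graph_annihilation (k z : K) {x x' : Fock K}
    (h : (x, x') ∈ (annihilation k).graph) :
    (weyl z x, weyl z x' + ⟪k, z⟫_ℂ • weyl z x) ∈ (annihilation k).graph := by
  rw [graph_annihilation] at h ⊢
  let T : Fock K × Fock K →L[ℂ] Fock K × Fock K :=
    ((weyl z).comp (ContinuousLinearMap.fst ℂ _ _)).prod
      ((weyl z).comp (ContinuousLinearMap.snd ℂ _ _) +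
        ⟪k, z⟫_ℂ • (weyl z).comp (ContinuousLinearMap.fst ℂ _ _))
  have hle : annGraph k ≤ (annGraph k).comap (T : Fock K × Fock K →ₗ[ℂ] Fock K × Fock K) := by
    refine Submodule.topologicalClosure_minimal _ (Submodule.span_le.2 ?_)
      ((Submodule.isClosed_topologicalClosure _).preimage T.continuous)
    rintro _ ⟨f, rfl⟩
    have e : T (expVec f, ⟪k, f⟫_ℂ • expVec f) =
        Complex.exp (-((‖z‖ : ℂ) ^ 2) / 2 - ⟪z, f⟫_ℂ) •
          (expVec (f + z), ⟪k, f + z⟫_ℂ • expVec (f + z)) := by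
      apply Prod.ext
      · exact weyl_expVec z f
      · change weyl z (⟪k, f⟫_ℂ • expVec f) + ⟪k, z⟫_ℂ • weyl z (expVec f) = _
        rw [map_smul, weyl_expVec, shiftedExpVec, ← add_smul, ← inner_add_right, smul_comm]
        rfl
    have hm : T (expVec f, ⟪k, f⟫_ℂ • expVec f) ∈ annGraph k := by
      rw [e]
      exact Submodule.smul_mem _ _
        (Submodule.le_topologicalClosure _ (Submodule.subset_span ⟨f + z, rfl⟩))
    exact hm
  exact hle h

theorem dense_domain_annihilation (k : K) : Dense ((annihilation k).domain : Set (Fock K)) := by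
  refine dense_span_expVec.mono (Submodule.span_le.2 ?_)
  rintro _ ⟨f, rfl⟩
  exact ⟨(expVec f, ⟪k, f⟫_ℂ • expVec f),
    Submodule.le_topologicalClosure _ (Submodule.subset_span ⟨f, rfl⟩), rfl⟩

theorem inner_annihilation_eq_inner_creation {k : K} {x x' y y' : Fock K}
    (hx : (x, x') ∈ (annihilation k).graph) (hy : (y, y') ∈ (creation k).graph) :
    ⟪x', y⟫_ℂ = ⟪x, y'⟫_ℂ := by
  rw [LinearPMap.mem_graph_iff] at hx hy
  obtain ⟨x, rfl, rfl⟩ := hx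
  obtain ⟨y, rfl, rfl⟩ := hy
  exact (LinearPMap.adjoint_isFormalAdjoint (dense_domain_annihilation k)).symm x y

/-- `a(k) U(z) - U(z) a(k) = ⟪k, z⟫ U(z)`, against a vector of the domain of `a⁺(k)`. -/
theorem inner_creation_weyl {k : K} (z : K) {x x' y y' : Fock K}
    (hx : (x, x') ∈ (creation k).graph) (hy : (y, y') ∈ (annihilation k).graph) :
    ⟪x', weyl z y⟫_ℂ = ⟪x, weyl z y'⟫_ℂ + ⟪k, z⟫_ℂ * ⟪x, weyl z y⟫_ℂ := by
  have h := inner_annihilation_eq_inner_creation (weyl_mem_graph_annihilation k z hy) hx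
  rw [← inner_conj_symm, ← h, inner_conj_symm, inner_add_right, inner_smul_right]

/-- `a⁺(k) U(z) - U(z) a⁺(k) = ⟪z, k⟫ U(z)`, against a vector of the domain of `a(k)`. -/
theorem inner_annihilation_weyl {k : K} (z : K) {x x' y y' : Fock K}
    (hx : (x, x') ∈ (annihilation k).graph) (hy : (y, y') ∈ (creation k).graph) :
    ⟪x', weyl z y⟫_ℂ = ⟪x, weyl z y'⟫_ℂ + ⟪z, k⟫_ℂ * ⟪x, weyl z y⟫_ℂ := by
  have h := inner_annihilation_eq_inner_creation (weyl_mem_graph_annihilation k (-z) hx) hy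
  rw [inner_add_left, inner_smul_left, inner_weyl_left, inner_weyl_left, inner_weyl_left, neg_neg,
    inner_neg_right, map_neg, inner_conj_symm] at h
  rw [← h]
  ring

end Annihilation

/-! ### Commutators of position and momentum with Weyl operators -/

section Commutators

/-- A weak commutation relation between operators and a bounded operator passes to closures. -/
theorem commutation_closure {F : Type*} [NormedAddCommGroup F] [InnerProductSpace ℂ F]
    {A B : F →ₗ.[ℂ] F} {W : F →L[ℂ] F} {c : ℂ}
    (h : ∀ p ∈ A.graph, ∀ q ∈ B.graph, ⟪p.2, W q.1⟫_ℂ - ⟪p.1, W q.2⟫_ℂ = c * ⟪p.1, W q.1⟫_ℂ) :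
    ∀ p ∈ A.closure.graph, ∀ q ∈ B.closure.graph,
      ⟪p.2, W q.1⟫_ℂ - ⟪p.1, W q.2⟫_ℂ = c * ⟪p.1, W q.1⟫_ℂ := by
  -- This holds for non-closable operators too, since `LinearPMap.closure` leaves them unchanged.
  have hcl : ∀ A : F →ₗ.[ℂ] F, ∀ p ∈ A.closure.graph, p ∈ closure (A.graph : Set (F × F)) := by
    intro A p hp
    by_cases hA : A.IsClosable
    · rw [← hA.graph_closure_eq_closure_graph] at hp
      exact hp
    · rw [LinearPMap.closure_def' hA] at hp
      exact subset_closure hp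
  have h1 : ∀ p ∈ A.graph, ∀ q ∈ closure (B.graph : Set (F × F)),
      ⟪p.2, W q.1⟫_ℂ - ⟪p.1, W q.2⟫_ℂ = c * ⟪p.1, W q.1⟫_ℂ := fun p hp q hq =>
    closure_minimal (fun q hq => h p hp q hq) (isClosed_eq (by fun_prop) (by fun_prop)) hq
  intro p hp q hq
  exact closure_minimal (s := (A.graph : Set (F × F)))
    (t := {p | ⟪p.2, W q.1⟫_ℂ - ⟪p.1, W q.2⟫_ℂ = c * ⟪p.1, W q.1⟫_ℂ})
    (fun p hp => h1 p hp q (hcl B q hq)) (isClosed_eq (by fun_prop) (by fun_prop)) (hcl A p hp)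

variable {H : Type u} [NormedAddCommGroup H] [InnerProductSpace ℝ H]

theorem conj_conj (k : Cplx H) : k.conj.conj = k := by
  apply Cplx.ext <;> simp [Cplx.conj]

theorem mem_graph_add {F : Type*} [AddCommGroup F] [Module ℂ F] {A B : F →ₗ.[ℂ] F} {p : F × F}
    (h : p ∈ (A + B).graph) : ∃ a b, (p.1, a) ∈ A.graph ∧ (p.1, b) ∈ B.graph ∧ p.2 = a + b := by
  rw [LinearPMap.mem_graph_iff] at h
  obtain ⟨y, h1, h2⟩ := h
  have hy := (Submodule.mem_inf.1 y.2)
  refine ⟨A ⟨y, hy.1⟩, B ⟨y, hy.2⟩, ?_, ?_, ?_⟩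
  · rw [← h1]; exact LinearPMap.mem_graph A ⟨y, hy.1⟩
  · rw [← h1]; exact LinearPMap.mem_graph B ⟨y, hy.2⟩
  · rw [← h2]; rfl

theorem mem_graph_smul_sub {F : Type*} [AddCommGroup F] [Module ℂ F] {A B : F →ₗ.[ℂ] F} {c : ℂ}
    {p : F × F} (h : p ∈ (c • (A - B)).graph) :
    ∃ a b, (p.1, a) ∈ A.graph ∧ (p.1, b) ∈ B.graph ∧ p.2 = c • (a - b) := by
  rw [LinearPMap.mem_graph_iff] at h
  obtain ⟨y, h1, h2⟩ := h
  have hy := (Submodule.mem_inf.1 y.2)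
  refine ⟨A ⟨y, hy.1⟩, B ⟨y, hy.2⟩, ?_, ?_, ?_⟩
  · rw [← h1]; exact LinearPMap.mem_graph A ⟨y, hy.1⟩
  · rw [← h1]; exact LinearPMap.mem_graph B ⟨y, hy.2⟩
  · rw [← h2]; rfl

theorem inner_conj_mk (h₁ h₂ : H) (k : Cplx H) (s : ℝ × ℝ) :
    ⟪k.conj, Cplx.mk (s.1 • h₁) (s.2 • h₂)⟫_ℂ =
      s.1 * ⟪Cplx.ofReal h₁, k⟫_ℂ + I * s.2 * ⟪Cplx.ofReal h₂, k⟫_ℂ := by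
  simp only [Cplx.inner_def, Cplx.conj, Cplx.ofReal, Cplx.re_mk, Cplx.im_mk, inner_smul_right,
    inner_neg_left, inner_zero_left]
  apply Complex.ext
  · simp [real_inner_comm]
  · simp [real_inner_comm]
    ring

theorem inner_mk_left (h₁ h₂ : H) (k : Cplx H) (s : ℝ × ℝ) :
    ⟪Cplx.mk (s.1 • h₁) (s.2 • h₂), k⟫_ℂ =
      s.1 * ⟪Cplx.ofReal h₁, k⟫_ℂ - I * s.2 * ⟪Cplx.ofReal h₂, k⟫_ℂ := by
  simp only [Cplx.inner_def, Cplx.ofReal, Cplx.re_mk, Cplx.im_mk, inner_smul_left,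
    inner_zero_left]
  apply Complex.ext <;> simp

/-- `Q(k) U(s) - U(s) Q(k) = 2 s₁ ⟪h₁, k⟫ U(s)`, with `Q(k)` acting to the left as `Q(k̄)`. -/
theorem position_commutation (h₁ h₂ : H) (k : Cplx H) (s : ℝ × ℝ) {x x' y y' : Fock (Cplx H)}
    (hx : (x, x') ∈ (Q k.conj).graph) (hy : (y, y') ∈ (Q k).graph) :
    2 * ⟪Cplx.ofReal h₁, k⟫_ℂ * s.1 * weylCoeff h₁ h₂ x y s =
      weylCoeff h₁ h₂ x' y s - weylCoeff h₁ h₂ x y' s := by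
  refine (commutation_closure (W := planeWeyl h₁ h₂ s) (c := 2 * ⟪Cplx.ofReal h₁, k⟫_ℂ * s.1)
    ?_ _ hx _ hy).symm
  intro p hp q hq
  obtain ⟨a', b', ha', hb', hp2⟩ := mem_graph_add hp
  obtain ⟨a, b, ha, hb, hq2⟩ := mem_graph_add hq
  rw [conj_conj] at ha'
  rw [hp2, hq2, planeWeyl, inner_add_left, inner_annihilation_weyl _ ha' hb,
    inner_creation_weyl _ hb' ha, map_add, inner_add_right, inner_conj_mk, inner_mk_left]
  ring

/-- `P(k) U(s) - U(s) P(k) = -2 s₂ ⟪h₂, k⟫ U(s)`, with `P(k)` acting to the left as `P(k̄)`. -/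
theorem momentum_commutation (h₁ h₂ : H) (k : Cplx H) (s : ℝ × ℝ) {x x' y y' : Fock (Cplx H)}
    (hx : (x, x') ∈ (P k.conj).graph) (hy : (y, y') ∈ (P k).graph) :
    -2 * ⟪Cplx.ofReal h₂, k⟫_ℂ * s.2 * weylCoeff h₁ h₂ x y s =
      weylCoeff h₁ h₂ x' y s - weylCoeff h₁ h₂ x y' s := by
  refine (commutation_closure (W := planeWeyl h₁ h₂ s) (c := -2 * ⟪Cplx.ofReal h₂, k⟫_ℂ * s.2)
    ?_ _ hx _ hy).symm
  intro p hp q hq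
  obtain ⟨a', b', ha', hb', hp2⟩ := mem_graph_smul_sub hp
  obtain ⟨a, b, ha, hb, hq2⟩ := mem_graph_smul_sub hq
  rw [conj_conj] at ha'
  rw [hp2, hq2, planeWeyl, inner_smul_left, inner_sub_left, inner_annihilation_weyl _ ha' hb,
    inner_creation_weyl _ hb' ha, map_smul, map_sub, inner_smul_right, inner_sub_right,
    inner_conj_mk, inner_mk_left, Complex.conj_I]
  linear_combination (2 * s.2 * ⟪Cplx.ofReal h₂, k⟫_ℂ *
    ⟪p.1, weyl (Cplx.mk (s.1 • h₁) (s.2 • h₂)) q.1⟫_ℂ) * Complex.I_mul_I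

end Commutators

/-! ### Weyl quantisation of Schwartz functions -/

section Quantization

variable {H : Type u} [NormedAddCommGroup H] [InnerProductSpace ℝ H] (h₁ h₂ : H)

theorem integrable_smul_planeWeyl {ψ : ℝ × ℝ → ℂ} (hψ : Integrable ψ) (y : Fock (Cplx H)) :
    Integrable fun s => ψ s • planeWeyl h₁ h₂ s y := by
  refine (hψ.norm.mul_const ‖y‖).mono' (hψ.aestronglyMeasurable.smul
    (continuous_planeWeyl_apply h₁ h₂ y).aestronglyMeasurable)
    (Filter.Eventually.of_forall fun s => ?_)
  rw [norm_smul, norm_planeWeyl_apply]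

/-- The weak integral `(2π)⁻¹ ∫ ψ(s) U(s) ds` is a bounded operator. -/
theorem exists_weyl_integral {ψ : ℝ × ℝ → ℂ} (hψ : Integrable ψ) :
    ∃ M : Fock (Cplx H) →L[ℂ] Fock (Cplx H), ∀ x y, ⟪x, M y⟫_ℂ =
      (1 / (2 * Real.pi) : ℂ) * ∫ s, weylCoeff h₁ h₂ x y s * ψ s := by
  let L : Fock (Cplx H) →ₗ[ℂ] Fock (Cplx H) :=
    { toFun := fun y => (1 / (2 * Real.pi) : ℂ) • ∫ s, ψ s • planeWeyl h₁ h₂ s y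
      map_add' := fun x y => by
        rw [← smul_add, ← integral_add (integrable_smul_planeWeyl h₁ h₂ hψ x)
          (integrable_smul_planeWeyl h₁ h₂ hψ y)]
        simp only [map_add, smul_add]
      map_smul' := fun c y => by
        have h : ∀ s, ψ s • planeWeyl h₁ h₂ s (c • y) = c • (ψ s • planeWeyl h₁ h₂ s y) :=
          fun s => by rw [map_smul, smul_comm]
        simp only [h]
        rw [integral_smul, smul_comm, RingHom.id_apply] }
  refine ⟨L.mkContinuous (‖(1 / (2 * Real.pi) : ℂ)‖ * ∫ s, ‖ψ s‖) fun y => ?_, fun x y => ?_⟩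
  · change ‖(1 / (2 * Real.pi) : ℂ) • ∫ s, ψ s • planeWeyl h₁ h₂ s y‖ ≤ _
    rw [norm_smul, mul_assoc, ← integral_mul_const]
    refine mul_le_mul_of_nonneg_left (norm_integral_le_of_norm_le (hψ.norm.mul_const _)
      (Filter.Eventually.of_forall fun s => ?_)) (norm_nonneg _)
    rw [norm_smul, norm_planeWeyl_apply]
  · change ⟪x, (1 / (2 * Real.pi) : ℂ) • ∫ s, ψ s • planeWeyl h₁ h₂ s y⟫_ℂ = _
    rw [inner_smul_right, ← integral_inner (integrable_smul_planeWeyl h₁ h₂ hψ y)]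
    simp only [inner_smul_right, weylCoeff, mul_comm]

/-- A Weyl quantisation is determined by its matrix elements between exponential vectors, which
extends its defining formula to all vectors. -/
theorem inner_isWeylQuantization {φ : 𝓢(ℝ × ℝ, ℂ)} {M : Fock (Cplx H) →L[ℂ] Fock (Cplx H)}
    (hM : IsWeylQuantization h₁ h₂ φ M) (x y : Fock (Cplx H)) :
    ⟪x, M y⟫_ℂ = (1 / (2 * Real.pi) : ℂ) * ∫ s, weylCoeff h₁ h₂ x y s * invFourier φ s := by
  obtain ⟨M', hM'⟩ := exists_weyl_integral h₁ h₂ (integrable_invFourier φ)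
  have h : M = M' := by
    refine clm_ext_expVec fun g => ?_
    rw [← sub_eq_zero]
    refine eq_zero_of_forall_inner_expVec _ fun f => ?_
    rw [inner_sub_right, hM, hM', sub_eq_zero]
    simp only [weylCoeff, planeWeyl_expVec]
  rw [h, hM']

theorem mem_domO (φ : 𝓢(ℝ × ℝ, ℂ)) : (φ : ℝ × ℝ → ℂ) ∈ domO h₁ h₂ := by
  obtain ⟨M, hM⟩ := exists_weyl_integral h₁ h₂ (integrable_invFourier φ)
  refine ⟨M, fun f g => ?_⟩
  rw [hM]
  simp only [weylCoeff, planeWeyl_expVec]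

theorem vectorState_weylO (ω : Fock (Cplx H)) (φ : 𝓢(ℝ × ℝ, ℂ)) :
    vectorState ω (weylO h₁ h₂ φ) =
      (1 / (2 * Real.pi) : ℂ) * ∫ s, weylCoeff h₁ h₂ ω ω s * invFourier φ s := by
  have hφ : ∃ M, IsWeylQuantization h₁ h₂ φ M := mem_domO h₁ h₂ φ
  rw [vectorState, weylO, dif_pos hφ]
  exact inner_isWeylQuantization h₁ h₂ hφ.choose_spec ω ω

end Quantization

/-! ### Fourier transforms of derivatives of test functions -/

section TestFunctions

/-- Integration by parts: a directional derivative becomes multiplication by `i w·v`. -/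
theorem invFourier_fderiv {φ : ℝ × ℝ → ℝ} (hφ : ContDiff ℝ ((⊤ : ℕ∞) : WithTop ℕ∞) φ)
    (hs : HasCompactSupport φ) (v w : ℝ × ℝ) :
    invFourier (fun z => ((fderiv ℝ φ z v : ℝ) : ℂ)) w =
      I * (w.1 * v.1 + w.2 * v.2 : ℝ) * invFourier (fun z => (φ z : ℂ)) w := by
  let e : ℝ × ℝ → ℂ := fun z => Complex.exp (-I * ((w.1 * z.1 + w.2 * z.2 : ℝ) : ℂ))
  have he : Continuous e := by fun_prop
  have hφc := hφ.continuous
  have hφ'c : Continuous fun z => fderiv ℝ φ z v :=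
    (hφ.continuous_fderiv (by simp)).clm_apply continuous_const
  have h1 : Integrable fun z => (φ z : ℂ) * e z :=
    (by fun_prop : Continuous fun z => (φ z : ℂ) * e z).integrable_of_hasCompactSupport
      ((hs.comp_left (g := fun r : ℝ => (r : ℂ)) Complex.ofReal_zero).mul_right)
  have h2 : Integrable fun z => ((fderiv ℝ φ z v : ℝ) : ℂ) * e z :=
    (by fun_prop : Continuous fun z =>
      ((fderiv ℝ φ z v : ℝ) : ℂ) * e z).integrable_of_hasCompactSupport
      (((hs.fderiv_apply ℝ v).comp_left (g := fun r : ℝ => (r : ℂ)) Complex.ofReal_zero).mul_right)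
  set c : ℂ := -I * ((w.1 * v.1 + w.2 * v.2 : ℝ) : ℂ) with hc
  have hed : ∀ z, HasLineDerivAt ℝ e (c * e z) z v := by
    intro z
    have h3 : HasDerivAt
        (fun t : ℝ => -I * ((w.1 * z.1 + w.2 * z.2 : ℝ) : ℂ) + (t : ℂ) * c) c 0 := by
      simpa using! ((Complex.ofRealCLM.hasDerivAt (x := 0)).mul_const c).const_add
        (-I * ((w.1 * z.1 + w.2 * z.2 : ℝ) : ℂ))
    have h4 := h3.cexp
    have h5 : (fun t : ℝ => e (z + t • v)) =
        fun t : ℝ => Complex.exp (-I * ((w.1 * z.1 + w.2 * z.2 : ℝ) : ℂ) + (t : ℂ) * c) := by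
      ext t
      simp only [e, hc, Prod.fst_add, Prod.snd_add, Prod.smul_fst, Prod.smul_snd, smul_eq_mul]
      congr 1
      push_cast
      ring
    rw [Complex.ofReal_zero, zero_mul, add_zero, mul_comm _ c] at h4
    rw [HasLineDerivAt, h5]
    exact h4
  have hφd : ∀ z, HasLineDerivAt ℝ (fun z => (φ z : ℂ)) ((fderiv ℝ φ z v : ℝ) : ℂ) z v := by
    intro z
    have h3 :=
      ((hφ.differentiable (by simp)).differentiableAt (x := z)).hasFDerivAt.hasLineDerivAt v
    exact h3.ofReal_comp
  have h5 := integral_bilinear_hasLineDerivAt_right_eq_neg_left_of_integrable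
    (μ := (volume : Measure (ℝ × ℝ))) (B := ContinuousLinearMap.mul ℝ ℂ) (v := v)
    (f := e) (f' := fun z => c * e z) (g := fun z => (φ z : ℂ))
    (g' := fun z => ((fderiv ℝ φ z v : ℝ) : ℂ))
    (by
      refine (h1.const_mul c).congr (Filter.Eventually.of_forall fun z => ?_)
      simp only [ContinuousLinearMap.mul_apply']
      ring)
    (by
      refine h2.congr (Filter.Eventually.of_forall fun z => ?_)
      simp only [ContinuousLinearMap.mul_apply']
      ring)
    (by
      refine h1.congr (Filter.Eventually.of_forall fun z => ?_)
      simp only [ContinuousLinearMap.mul_apply']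
      ring) (fun z _ => hed z) (fun z _ => hφd z)
  simp only [ContinuousLinearMap.mul_apply'] at h5
  have h6 : ∫ z, ((fderiv ℝ φ z v : ℝ) : ℂ) * e z = -c * ∫ z, (φ z : ℂ) * e z := by
    rw [neg_mul, ← integral_const_mul]
    simp only [mul_comm _ (e _), h5]
    congr 2
    ext z
    ring
  simp only [invFourier]
  rw [h6, hc]
  ring

theorem contDiff_partialX {φ : ℝ × ℝ → ℝ} (hφ : ContDiff ℝ ((⊤ : ℕ∞) : WithTop ℕ∞) φ) :
    ContDiff ℝ ((⊤ : ℕ∞) : WithTop ℕ∞) (partialX φ) :=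
  (hφ.fderiv_right (m := ((⊤ : ℕ∞) : WithTop ℕ∞)) (by simp)).clm_apply contDiff_const

theorem contDiff_partialY {φ : ℝ × ℝ → ℝ} (hφ : ContDiff ℝ ((⊤ : ℕ∞) : WithTop ℕ∞) φ) :
    ContDiff ℝ ((⊤ : ℕ∞) : WithTop ℕ∞) (partialY φ) :=
  (hφ.fderiv_right (m := ((⊤ : ℕ∞) : WithTop ℕ∞)) (by simp)).clm_apply contDiff_const

/-- Partial derivatives of test functions are test functions, and their Fourier transforms are
monomial multiples of the original one. -/
theorem testFunction_iterate_partial {φ : ℝ × ℝ → ℝ}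
    (hφ : ContDiff ℝ ((⊤ : ℕ∞) : WithTop ℕ∞) φ) (hs : HasCompactSupport φ) (a b : ℕ) :
    ContDiff ℝ ((⊤ : ℕ∞) : WithTop ℕ∞) (partialX^[a] (partialY^[b] φ)) ∧
      HasCompactSupport (partialX^[a] (partialY^[b] φ)) ∧
      ∀ w : ℝ × ℝ, invFourier (fun z => ((partialX^[a] (partialY^[b] φ) z : ℝ) : ℂ)) w =
        I ^ (a + b) * (w.1 ^ a * w.2 ^ b) * invFourier (fun z => (φ z : ℂ)) w := by
  induction a with
  | zero =>
    induction b with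
    | zero => exact ⟨hφ, hs, fun w => by simp⟩
    | succ b ih =>
      rw [Function.iterate_zero, id_eq] at ih ⊢
      rw [Function.iterate_succ_apply']
      refine ⟨contDiff_partialY ih.1, ih.2.1.fderiv_apply ℝ _, fun w => ?_⟩
      have h := invFourier_fderiv ih.1 ih.2.1 (0, 1) w
      rw [ih.2.2] at h
      refine h.trans ?_
      push_cast
      ring
  | succ a ih =>
    rw [Function.iterate_succ_apply']
    refine ⟨contDiff_partialX ih.1, ih.2.1.fderiv_apply ℝ _, fun w => ?_⟩
    have h := invFourier_fderiv ih.1 ih.2.1 (1, 0) w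
    rw [ih.2.2] at h
    refine h.trans ?_
    push_cast
    ring

/-- A real test function as a complex Schwartz function. -/
def testSchwartz {φ : ℝ × ℝ → ℝ} (hφ : ContDiff ℝ ((⊤ : ℕ∞) : WithTop ℕ∞) φ)
    (hs : HasCompactSupport φ) : 𝓢(ℝ × ℝ, ℂ) :=
  HasCompactSupport.toSchwartzMap (f := fun z => (φ z : ℂ))
    (hs.comp_left (g := fun r : ℝ => (r : ℂ)) Complex.ofReal_zero)
    (Complex.ofRealCLM.contDiff.comp hφ)

theorem coe_testSchwartz {φ : ℝ × ℝ → ℝ} (hφ : ContDiff ℝ ((⊤ : ℕ∞) : WithTop ℕ∞) φ)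
    (hs : HasCompactSupport φ) : ⇑(testSchwartz hφ hs) = fun z => (φ z : ℂ) := rfl

theorem invFourier_neg_of_real (φ : ℝ × ℝ → ℝ) (s : ℝ × ℝ) :
    invFourier (fun z => (φ z : ℂ)) (-s) =
      starRingEnd ℂ (invFourier (fun z => (φ z : ℂ)) s) := by
  rw [invFourier, invFourier, map_mul, ← integral_conj]
  congr 1
  · rw [map_div₀, map_one, map_mul, map_ofNat, Complex.conj_ofReal]
  · congr 1
    ext z
    rw [map_mul, Complex.conj_ofReal, ← Complex.exp_conj, map_mul, map_neg, Complex.conj_I,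
      Complex.conj_ofReal]
    congr 2
    simp only [Prod.fst_neg, Prod.snd_neg]
    push_cast
    ring

end TestFunctions

/-! ### Moments of the characteristic function -/

section Moments

/-- The value `Tⁿ x` of a power of an unbounded operator, and `0` outside the domain. -/
def powValue {F : Type*} [AddCommGroup F] [Module ℂ F] (T : F →ₗ.[ℂ] F) (n : ℕ) (x : F) : F :=
  open Classical in if h : x ∈ (opPow T n).domain then opPow T n ⟨x, h⟩ else 0

theorem powValue_zero {F : Type*} [AddCommGroup F] [Module ℂ F] (T : F →ₗ.[ℂ] F) (x : F) :
    powValue T 0 x = x :=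
  dif_pos (c := x ∈ (opPow T 0).domain) (Submodule.mem_top (R := ℂ))

theorem powValue_succ_mem_graph {F : Type*} [AddCommGroup F] [Module ℂ F] {T : F →ₗ.[ℂ] F} {n : ℕ}
    {x : F} (h : x ∈ (opPow T (n + 1)).domain) :
    (powValue T n x, powValue T (n + 1) x) ∈ T.graph := by
  obtain ⟨hx, hT⟩ := (mem_opMul_domain T (opPow T n) x).1 h
  have h1 : powValue T n x = opPow T n ⟨x, hx⟩ := dif_pos hx
  have h2 : powValue T (n + 1) x = T ⟨opPow T n ⟨x, hx⟩, hT⟩ := dif_pos h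
  rw [h1, h2]
  exact T.mem_graph ⟨_, hT⟩

/-- The vectors `Aʲ Bⁱ x`, `i + j ≤ κ`, for a vector `x` in the domains of these products. -/
theorem exists_orbit {F : Type*} [AddCommGroup F] [Module ℂ F] {A B : F →ₗ.[ℂ] F} {x : F} {κ : ℕ}
    (h : ∀ j i, j + i ≤ κ → x ∈ (opMul (opPow A j) (opPow B i)).domain) :
    ∃ y : ℕ → ℕ → F, y 0 0 = x ∧ (∀ i, i + 1 ≤ κ → (y 0 i, y 0 (i + 1)) ∈ B.graph) ∧
      ∀ j i, j + 1 + i ≤ κ → (y j i, y (j + 1) i) ∈ A.graph := by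
  refine ⟨fun j i => powValue A j (powValue B i x), ?_, fun i hi => ?_, fun j i hji => ?_⟩
  · simp only [powValue_zero]
  · simp only [powValue_zero]
    obtain ⟨hx, -⟩ := (mem_opMul_domain _ _ x).1 (h 0 (i + 1) (by omega))
    exact powValue_succ_mem_graph hx
  · obtain ⟨hx, hA⟩ := (mem_opMul_domain _ _ x).1 (h (j + 1) i hji)
    have h1 : powValue B i x = opPow B i ⟨x, hx⟩ := dif_pos hx
    simp only [h1]
    exact powValue_succ_mem_graph hA

variable {H : Type u} [NormedAddCommGroup H] [InnerProductSpace ℝ H] {h₁ h₂ : H}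

/-- The linear span of all matrix coefficients of the Weyl operators. -/
def coeffSpan (h₁ h₂ : H) : Submodule ℂ (ℝ × ℝ → ℂ) :=
  Submodule.span ℂ (Set.range fun p : Fock (Cplx H) × Fock (Cplx H) => weylCoeff h₁ h₂ p.1 p.2)

/-- If `ω` lies in the domains of the products of order at most `κ`, the products of monomials of
degree at most `κ` with the characteristic function of `ω` are combinations of matrix
coefficients: the commutation relations trade a coordinate for an operator acting on one side. -/
theorem monomial_mul_weylCoeff_mem_coeffSpan {κ : ℕ} {ω : Fock (Cplx H)} {k₁ k₂ : Cplx H}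
    (hk₁ : ⟪Cplx.ofReal h₁, k₁⟫_ℂ ≠ 0) (hk₂ : ⟪Cplx.ofReal h₂, k₂⟫_ℂ ≠ 0)
    (hω : ∀ j i, j + i ≤ κ → ω ∈ (opMul (opPow (Q k₁) j) (opPow (P k₂) i)).domain)
    (hω' : ∀ j i, j + i ≤ κ → ω ∈ (opMul (opPow (Q k₁.conj) j) (opPow (P k₂.conj) i)).domain)
    {a b : ℕ} (hab : a + b ≤ κ) :
    (fun s : ℝ × ℝ => (s.1 : ℂ) ^ a * (s.2 : ℂ) ^ b * weylCoeff h₁ h₂ ω ω s) ∈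
      coeffSpan h₁ h₂ := by
  obtain ⟨y, hy0, hyP, hyQ⟩ := exists_orbit hω
  obtain ⟨x, hx0, hxP, hxQ⟩ := exists_orbit hω'
  -- Coefficients with `a` factors `Q` and `b` factors `P` distributed over both sides.
  let T : ℕ → ℕ → Submodule ℂ (ℝ × ℝ → ℂ) := fun a b => Submodule.span ℂ
    {B | ∃ j j' i i' : ℕ, j + j' = a ∧ i + i' = b ∧ B = weylCoeff h₁ h₂ (x j i) (y j' i')}
  -- The powers of `P` act first, so `s₂` can be traded only before any factor `Q` is present.
  have hP : ∀ b, b + 1 ≤ κ → ∀ B ∈ T 0 b, (fun s : ℝ × ℝ => (s.2 : ℂ) * B s) ∈ T 0 (b + 1) := by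
    intro b hb
    let m : (ℝ × ℝ → ℂ) →ₗ[ℂ] (ℝ × ℝ → ℂ) := LinearMap.mulLeft ℂ fun s : ℝ × ℝ => (s.2 : ℂ)
    have hle : T 0 b ≤ (T 0 (b + 1)).comap m := by
      refine Submodule.span_le.2 ?_
      rintro _ ⟨j, j', i, i', hj, rfl, rfl⟩
      obtain ⟨rfl, rfl⟩ : j = 0 ∧ j' = 0 := by omega
      have e : m (weylCoeff h₁ h₂ (x 0 i) (y 0 i')) = (-2 * ⟪Cplx.ofReal h₂, k₂⟫_ℂ)⁻¹ •
          (weylCoeff h₁ h₂ (x 0 (i + 1)) (y 0 i') - weylCoeff h₁ h₂ (x 0 i) (y 0 (i' + 1))) := by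
        ext s
        have h1 := momentum_commutation h₁ h₂ k₂ s (hxP i (by omega)) (hyP i' (by omega))
        simp only [Pi.smul_apply, Pi.sub_apply, smul_eq_mul]
        rw [← h1]
        change (s.2 : ℂ) * _ = _
        field_simp
      change m _ ∈ T 0 _
      rw [e]
      exact Submodule.smul_mem _ _ (Submodule.sub_mem _
        (Submodule.subset_span ⟨0, 0, i + 1, i', rfl, by omega, rfl⟩)
        (Submodule.subset_span ⟨0, 0, i, i' + 1, rfl, by omega, rfl⟩))
    exact fun B hB => hle hB
  have hQ : ∀ a b, a + 1 + b ≤ κ → ∀ B ∈ T a b,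
      (fun s : ℝ × ℝ => (s.1 : ℂ) * B s) ∈ T (a + 1) b := by
    intro a b hb
    let m : (ℝ × ℝ → ℂ) →ₗ[ℂ] (ℝ × ℝ → ℂ) := LinearMap.mulLeft ℂ fun s : ℝ × ℝ => (s.1 : ℂ)
    have hle : T a b ≤ (T (a + 1) b).comap m := by
      refine Submodule.span_le.2 ?_
      rintro _ ⟨j, j', i, i', rfl, rfl, rfl⟩
      have e : m (weylCoeff h₁ h₂ (x j i) (y j' i')) = (2 * ⟪Cplx.ofReal h₁, k₁⟫_ℂ)⁻¹ •
          (weylCoeff h₁ h₂ (x (j + 1) i) (y j' i') - weylCoeff h₁ h₂ (x j i) (y (j' + 1) i')) := by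
        ext s
        have h1 := position_commutation h₁ h₂ k₁ s (hxQ j i (by omega)) (hyQ j' i' (by omega))
        simp only [Pi.smul_apply, Pi.sub_apply, smul_eq_mul]
        rw [← h1]
        change (s.1 : ℂ) * _ = _
        field_simp
      change m _ ∈ T _ _
      rw [e]
      exact Submodule.smul_mem _ _ (Submodule.sub_mem _
        (Submodule.subset_span ⟨j + 1, j', i, i', by omega, rfl, rfl⟩)
        (Submodule.subset_span ⟨j, j' + 1, i, i', by omega, rfl, rfl⟩))
    exact fun B hB => hle hB
  have hmem : (fun s : ℝ × ℝ => (s.1 : ℂ) ^ a * (s.2 : ℂ) ^ b * weylCoeff h₁ h₂ ω ω s) ∈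
      T a b := by
    induction a with
    | zero =>
      induction b with
      | zero =>
        refine Submodule.subset_span ⟨0, 0, 0, 0, rfl, rfl, ?_⟩
        rw [hx0, hy0]
        ext s
        simp
      | succ b ih =>
        convert hP b (by omega) _ (ih (by omega)) using 1
        ext s
        ring
    | succ a ih =>
      convert hQ a b (by omega) _ (ih (by omega)) using 1
      ext s
      ring
  refine Submodule.span_mono ?_ hmem
  rintro _ ⟨j, j', i, i', -, -, rfl⟩
  exact ⟨(x j i, y j' i'), rfl⟩

theorem integrable_mul_invFourier {B : ℝ × ℝ → ℂ} (hB : B ∈ coeffSpan h₁ h₂)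
    (φ : 𝓢(ℝ × ℝ, ℂ)) : Integrable fun s => B s * invFourier φ s := by
  induction hB using Submodule.span_induction with
  | mem B hB =>
    obtain ⟨p, rfl⟩ := hB
    exact (integrable_invFourier φ).bdd_mul
      (continuous_weylCoeff h₁ h₂ p.1 p.2).aestronglyMeasurable
      (Filter.Eventually.of_forall fun s => norm_weylCoeff_le h₁ h₂ p.1 p.2 s)
  | zero => simp
  | add B B' _ _ h h' =>
    simp only [Pi.add_apply, add_mul]
    exact h.add h'
  | smul c B _ h =>
    simp only [Pi.smul_apply, smul_eq_mul, mul_assoc]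
    exact h.const_mul c

theorem integrable_schwartz_mul {W : ℝ × ℝ → ℂ} (hW : MemLp W 2) (φ : 𝓢(ℝ × ℝ, ℂ)) :
    Integrable fun z => φ z * W z :=
  MemLp.integrable_mul (p := 2) (q := 2) (φ.memLp 2) hW

/-- Combinations of matrix coefficients have Fourier transforms in `L² ∩ L^∞`. -/
theorem exists_isWeylFourier_of_mem_coeffSpan (hh : ⟪h₁, h₂⟫_ℝ ≠ 0) {B : ℝ × ℝ → ℂ}
    (hB : B ∈ coeffSpan h₁ h₂) :
    ∃ W : ℝ × ℝ → ℂ, MemLp W 2 ∧ MemLp W ∞ ∧ IsWeylFourier B W := by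
  induction hB using Submodule.span_induction with
  | mem B hB =>
    obtain ⟨⟨x, y⟩, rfl⟩ := hB
    obtain ⟨W, hW2, hW⟩ := exists_isWeylFourier (memLp_two_weylCoeff hh x y)
    refine ⟨W, hW2, memLp_top_of_bound hW2.1 _ (ae_norm_le_of_norm_integral_le
      (C := (1 / (2 * Real.pi)) ^ 2 * (2 * Real.pi / |⟪h₁, h₂⟫_ℝ| * (‖x‖ * ‖y‖)))
      (hW2.locallyIntegrable (by norm_num)) fun φ => ?_), hW⟩
    rw [mul_assoc]
    exact hW.norm_integral_le (continuous_weylCoeff h₁ h₂ x y) (norm_weylCoeff_le h₁ h₂ x y)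
      (fun ε hε ξ => norm_integral_modGaussian_mul_weylCoeff_le hh x y hε ξ) φ
  | zero => exact ⟨0, MemLp.zero, MemLp.zero, fun φ => by simp⟩
  | add B B' hB hB' h h' =>
    obtain ⟨W, h2, ht, hW⟩ := h
    obtain ⟨W', h2', ht', hW'⟩ := h'
    refine ⟨W + W', h2.add h2', ht.add ht', fun φ => ?_⟩
    simp only [Pi.add_apply, mul_add, add_mul]
    rw [integral_add (integrable_schwartz_mul h2 φ) (integrable_schwartz_mul h2' φ),
      integral_add (integrable_mul_invFourier hB φ) (integrable_mul_invFourier hB' φ), hW, hW',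
      mul_add]
  | smul c B hB h =>
    obtain ⟨W, h2, ht, hW⟩ := h
    refine ⟨c • W, h2.const_smul c, ht.const_smul c, fun φ => ?_⟩
    simp only [Pi.smul_apply, smul_eq_mul, mul_assoc, mul_left_comm _ c]
    rw [integral_const_mul, integral_const_mul, hW]
    ring

end Moments

/-! ### The Wigner density -/

section WignerDensity

variable {H : Type u} [NormedAddCommGroup H] [InnerProductSpace ℝ H] {h₁ h₂ : H}

theorem integral_testFunction_mul_re {W : ℝ × ℝ → ℂ} (hW : MemLp W 2) {φ : ℝ × ℝ → ℝ}
    (hφ : ContDiff ℝ ((⊤ : ℕ∞) : WithTop ℕ∞) φ) (hs : HasCompactSupport φ) :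
    ∫ z, φ z * (W z).re = (∫ z, testSchwartz hφ hs z * W z).re := by
  have h := integral_re (𝕜 := ℂ) (integrable_schwartz_mul hW (testSchwartz hφ hs))
  simp only [RCLike.re_to_complex] at h
  rw [← h]
  congr 1
  ext z
  rw [coe_testSchwartz, Complex.re_ofReal_mul]

/-- The characteristic function `χ` satisfies `χ(-s) = conj χ(s)`, hence its Fourier transform is
real-valued. -/
theorem ofReal_re_ae_eq {ω : Fock (Cplx H)} {W : ℝ × ℝ → ℂ} (hW2 : MemLp W 2)
    (hW : IsWeylFourier (weylCoeff h₁ h₂ ω ω) W) : ∀ᵐ z, (((W z).re : ℝ) : ℂ) = W z := by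
  have hloc : LocallyIntegrable fun z => (W z).im := hW2.im.locallyIntegrable (by norm_num)
  have h0 : ∀ᵐ z, (W z).im = 0 := by
    refine ae_eq_zero_of_integral_contDiff_smul_eq_zero hloc fun φ hφ hs => ?_
    have h := integral_im (𝕜 := ℂ) (integrable_schwartz_mul hW2 (testSchwartz hφ hs))
    have e : ∀ z, φ z • (W z).im = RCLike.im (testSchwartz hφ hs z * W z) := fun z => by
      rw [coe_testSchwartz, RCLike.im_to_complex, Complex.im_ofReal_mul, smul_eq_mul]
    simp_rw [e]
    rw [h, hW, RCLike.im_to_complex, ← Complex.conj_eq_iff_im, map_mul, map_div₀, map_one, map_mul,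
      map_ofNat, Complex.conj_ofReal, ← integral_conj, ← integral_neg_eq_self]
    congr 2
    ext s
    rw [coe_testSchwartz, invFourier_neg_of_real, weylCoeff_neg, map_mul, Complex.conj_conj,
      Complex.conj_conj]
  filter_upwards [h0] with z hz
  exact Complex.ext (by simp) (by simp [hz])

theorem isWignerDensity_re {ω : Fock (Cplx H)} {W : ℝ × ℝ → ℂ} (hW2 : MemLp W 2)
    (hW : IsWeylFourier (weylCoeff h₁ h₂ ω ω) W) :
    IsWignerDensity h₁ h₂ (vectorState ω) fun z => (W z).re := by
  refine ⟨hW2.re.locallyIntegrable (by norm_num), fun φ => ⟨mem_domO h₁ h₂ φ, ?_, ?_⟩⟩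
  · refine (integrable_schwartz_mul hW2 φ).congr ?_
    filter_upwards [ofReal_re_ae_eq hW2 hW] with z hz
    rw [hz]
  · rw [vectorState_weylO, ← hW φ]
    refine integral_congr_ae ?_
    filter_upwards [ofReal_re_ae_eq hW2 hW] with z hz
    rw [hz]

/-- Wigner densities are unique almost everywhere. -/
theorem IsWignerDensity.ae_eq {Φ : (Fock (Cplx H) →L[ℂ] Fock (Cplx H)) → ℂ} {w w' : ℝ × ℝ → ℝ}
    (hw : IsWignerDensity h₁ h₂ Φ w) (hw' : IsWignerDensity h₁ h₂ Φ w') : w =ᵐ[volume] w' := by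
  refine ae_eq_of_integral_contDiff_smul_eq hw.1 hw'.1 fun φ hφ hs => ?_
  have h := ((hw.2 (testSchwartz hφ hs)).2.2).trans ((hw'.2 (testSchwartz hφ hs)).2.2).symm
  simp only [coe_testSchwartz, ← Complex.ofReal_mul] at h
  rw [integral_complex_ofReal, integral_complex_ofReal] at h
  exact_mod_cast h

/-- Multiplication of the characteristic function by monomials corresponds to differentiation of
the density. -/
theorem isWeakDeriv_re {B W W' : ℝ × ℝ → ℂ} (hW2 : MemLp W 2) (hW : IsWeylFourier B W) {a b : ℕ}
    (hW2' : MemLp W' 2)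
    (hW' : IsWeylFourier (fun s => (s.1 : ℂ) ^ a * (s.2 : ℂ) ^ b * B s) W') :
    IsWeakDeriv a b (fun z => (W z).re) fun z => ((-I) ^ (a + b) * W' z).re := by
  intro φ hφ hs
  obtain ⟨hφ', hs', hF⟩ := testFunction_iterate_partial hφ hs a b
  rw [integral_testFunction_mul_re hW2 hφ' hs',
    integral_testFunction_mul_re (hW2'.const_mul _) hφ hs, hW]
  have h1 : ∀ s, B s * invFourier (testSchwartz hφ' hs') s = I ^ (a + b) *
      ((s.1 : ℂ) ^ a * (s.2 : ℂ) ^ b * B s * invFourier (testSchwartz hφ hs) s) := by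
    intro s
    rw [coe_testSchwartz, coe_testSchwartz, hF]
    ring
  simp_rw [h1, mul_left_comm _ ((-I) ^ (a + b))]
  rw [integral_const_mul, integral_const_mul, mul_left_comm, ← hW' (testSchwartz hφ hs)]
  -- The constant `(-i) ^ (a + b)` absorbs the sign in the definition of weak derivatives.
  have h2 : I ^ (a + b) = (((-1) ^ (a + b) : ℝ) : ℂ) * (-I) ^ (a + b) := by
    push_cast
    rw [← mul_pow]
    simp
  rw [h2, mul_assoc, Complex.re_ofReal_mul]

theorem MemSobolev.congr_ae {p : ℝ≥0∞} {κ : ℕ} {w w' : ℝ × ℝ → ℝ} (h : MemSobolev p κ w)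
    (hw : w =ᵐ[volume] w') : MemSobolev p κ w' := by
  refine ⟨h.1.ae_eq hw, fun a b hab => ?_⟩
  obtain ⟨g, hg, hd⟩ := h.2 a b hab
  refine ⟨g, hg, fun φ hφ hs => ?_⟩
  rw [← hd φ hφ hs]
  refine integral_congr_ae ?_
  filter_upwards [hw] with z hz
  rw [hz]

end WignerDensity

end FockWigner

end

theorem mainTheorem2 {H : Type u} [NormedAddCommGroup H] [InnerProductSpace ℝ H]
    [CompleteSpace H] [TopologicalSpace.SeparableSpace H]
    (κ : ℕ) (h₁ h₂ : H) (hh : inner ℝ h₁ h₂ ≠ 0)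
    (ω : FockWigner.Fock (FockWigner.Cplx H)) (hω : ‖ω‖ = 1)
    (hk : ∃ k₁ k₂ : FockWigner.Cplx H,
      inner ℂ (FockWigner.Cplx.ofReal h₁) k₁ ≠ 0 ∧
      inner ℂ (FockWigner.Cplx.ofReal h₂) k₂ ≠ 0 ∧
      ∀ κ₁ κ₂ : ℕ, κ₁ + κ₂ ≤ κ →
        ω ∈ (FockWigner.opMul (FockWigner.opPow (FockWigner.Q k₁) κ₁)
          (FockWigner.opPow (FockWigner.P k₂) κ₂)).domain ∧
        ω ∈ (FockWigner.opMul (FockWigner.opPow (FockWigner.Q k₁.conj) κ₁)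
          (FockWigner.opPow (FockWigner.P k₂.conj) κ₂)).domain) :
    (∃ w : ℝ × ℝ → ℝ,
      FockWigner.IsWignerDensity h₁ h₂ (FockWigner.vectorState ω) w) ∧
    ∀ w : ℝ × ℝ → ℝ, FockWigner.IsWignerDensity h₁ h₂ (FockWigner.vectorState ω) w →
      ∀ p : ENNReal, 2 ≤ p → FockWigner.MemSobolev p κ w := by
  obtain ⟨k₁, k₂, hk₁, hk₂, hdom⟩ := hk
  have hmem : FockWigner.weylCoeff h₁ h₂ ω ω ∈ FockWigner.coeffSpan h₁ h₂ :=
    Submodule.subset_span ⟨(ω, ω), rfl⟩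
  obtain ⟨W, hW2, hWt, hW⟩ := FockWigner.exists_isWeylFourier_of_mem_coeffSpan hh hmem
  have hdens := FockWigner.isWignerDensity_re hW2 hW
  refine ⟨⟨_, hdens⟩, fun w hw p hp => ?_⟩
  refine FockWigner.MemSobolev.congr_ae ⟨?_, fun a b hab => ?_⟩ (hdens.ae_eq hw)
  · exact (FockWigner.memLp_of_memLp_two_of_memLp_top hW2 hWt hp).re
  · obtain ⟨W', hW2', hWt', hW'⟩ := FockWigner.exists_isWeylFourier_of_mem_coeffSpan hh
      (FockWigner.monomial_mul_weylCoeff_mem_coeffSpan (h₁ := h₁) (h₂ := h₂) hk₁ hk₂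
        (fun j i hji => (hdom j i hji).1) (fun j i hji => (hdom j i hji).2) hab)
    exact ⟨_, ((FockWigner.memLp_of_memLp_two_of_memLp_top hW2' hWt' hp).const_mul _).re,
      FockWigner.isWeakDeriv_re hW2 hW hW2' hW'⟩
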